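/- Let $\mathcal H$ be a complex Hilbert space, $A$ a (possibly unbounded) self-adjoint operator on $\mathcal H$, and let $$\Xi^A_t(\rho)=\frac1{\sqrt{2\pi t}}\int_{-\infty}^{+\infty}e^{-iAx}\rho\,e^{iAx}e^{-x^2/(2t)}\,dx,\qquad t>0,$$ be the Gaussian convolution semigroup on the trace-class operators. Let $Z_A$ be its generator, $Z_A(\rho)=\lim_{t\to0^+}t^{-1}(\Xi^A_t(\rho)-\rho)$ in the trace norm, whose domain is the set of all trace-class $\rho$ for which this limit exists. A state is a positive operator of trace one. A densely defined operator $T$ is called square-summable with respect to a state $\rho$ if $\sqrt\rho\,T$, with domain $\mathcal D(T)$, extends to a Hilbert-Schmidt operator on $\mathcal H$, which is again denoted by $\sqrt\rho\,T$. If $\rho$ is a state such that $A^2$ (with domain $\{\varphi\in\mathcal D(A): A\varphi\in\mathcal D(A)\}$) is square-summable with respect to $\rho$, then $A$ is also square-summable with respect to $\rho$, $\rho$ belongs to the domain of $Z_A$, and $$Z_A(\rho)=(\sqrt\rho A)^*\sqrt\rho A-\tfrac12\left[(\sqrt\rho A^2)^*\sqrt\rho+\sqrt\rho\,(\sqrt\rho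 A^2)\right].$$ -/

import Mathlib

open MeasureTheory Filter Topology
open scoped ENNReal NNReal

noncomputable section

namespace GaussianSemigroup

variable {H : Type*} [NormedAddCommGroup H] [InnerProductSpace ℂ H] [CompleteSpace H]

/-! ### Hilbert-Schmidt and trace-class operators -/

/-- The sum `∑ i, ‖T (b i)‖ ^ 2` over an orthonormal basis `b`. -/
def hsSum {ι : Type*} (b : HilbertBasis ι ℂ H) (T : H →L[ℂ] H) : ℝ≥0∞ :=
  ∑' i, ‖T (b i)‖ₑ ^ 2

/-- The sum `∑ i, ⟪b i, P (b i)⟫` over an orthonormal basis `b`, for a positive operator `P`. -/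
def traceSum {ι : Type*} (b : HilbertBasis ι ℂ H) (P : H →L[ℂ] H) : ℝ≥0∞ :=
  ∑' i, ENNReal.ofReal (inner ℂ (b i) (P (b i))).re

variable (H) in
/-- The index set of a fixed orthonormal basis of `H`. -/
def stdIndex : Set H := (exists_hilbertBasis ℂ H).choose

variable (H) in
/-- A fixed orthonormal basis of `H`. -/
def stdBasis : HilbertBasis (stdIndex H) ℂ H := (exists_hilbertBasis ℂ H).choose_spec.choose

/-- The square of the Hilbert-Schmidt norm (it does not depend on the basis, see
`hsNormSq_eq`). -/
def hsNormSq (T : H →L[ℂ] H) : ℝ≥0∞ := hsSum (stdBasis H) T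

/-- `T` is a Hilbert-Schmidt operator. -/
def IsHilbertSchmidt (T : H →L[ℂ] H) : Prop := hsNormSq T < ∞

/-- The trace, with values in `[0, ∞]`, of a positive operator (it does not depend on the basis,
see `posTrace_eq`). -/
def posTrace (P : H →L[ℂ] H) : ℝ≥0∞ := traceSum (stdBasis H) P

/-- The trace norm `Tr |T|`, where `|T| = √(T* T)`; it is `∞` if `T` is not trace class. -/
def traceNorm (T : H →L[ℂ] H) : ℝ≥0∞ := posTrace (CFC.abs T)

/-- `T` is a trace-class operator. -/
def IsTraceClass (T : H →L[ℂ] H) : Prop := traceNorm T < ∞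

/-- `ρ` is a state (density operator): a positive operator of trace one. -/
def IsState (ρ : H →L[ℂ] H) : Prop := ρ.IsPositive ∧ posTrace ρ = 1

section BasisIndependence

lemma parseval {ι : Type*} (b : HilbertBasis ι ℂ H) (x : H) :
    ∑' i, ‖inner ℂ (b i) x‖ₑ ^ 2 = ‖x‖ₑ ^ 2 := by
  have h := lp.hasSum_norm (p := 2) (by norm_num) (b.repr x)
  simp only [ENNReal.toReal_ofNat, Real.rpow_ofNat, LinearIsometryEquiv.norm_map,
    HilbertBasis.repr_apply_apply] at h
  have h2 := ENNReal.ofReal_tsum_of_nonneg (fun i => by positivity) h.summable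
  rw [h.tsum_eq] at h2
  simpa [ENNReal.ofReal_pow, ofReal_norm] using h2.symm

lemma hsSum_adjoint {ι κ : Type*} (b : HilbertBasis ι ℂ H) (c : HilbertBasis κ ℂ H)
    (T : H →L[ℂ] H) : hsSum b T = hsSum c (ContinuousLinearMap.adjoint T) := by
  unfold hsSum
  calc ∑' i, ‖T (b i)‖ₑ ^ 2 = ∑' i, ∑' j, ‖inner ℂ (c j) (T (b i))‖ₑ ^ 2 := by
        simp_rw [parseval]
    _ = ∑' j, ∑' i, ‖inner ℂ (c j) (T (b i))‖ₑ ^ 2 := ENNReal.tsum_comm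
    _ = ∑' j, ∑' i, ‖inner ℂ (b i) (ContinuousLinearMap.adjoint T (c j))‖ₑ ^ 2 := by
        congr 1; ext j; congr 1; ext i
        rw [ContinuousLinearMap.adjoint_inner_right, ← ofReal_norm,
          ← ofReal_norm, norm_inner_symm]
    _ = _ := by simp_rw [parseval]

/-- The Hilbert-Schmidt norm may be computed in any orthonormal basis. -/
lemma hsNormSq_eq {ι : Type*} (b : HilbertBasis ι ℂ H) (T : H →L[ℂ] H) :
    hsNormSq T = hsSum b T := by
  rw [hsNormSq, hsSum_adjoint _ b, hsSum_adjoint b b, ContinuousLinearMap.adjoint_adjoint,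
    hsSum_adjoint b b]

lemma traceSum_eq_hsSum {ι : Type*} (b : HilbertBasis ι ℂ H) {P : H →L[ℂ] H}
    (hP : P.IsPositive) : traceSum b P = hsSum b (CFC.sqrt P) := by
  have h0 : 0 ≤ P := (ContinuousLinearMap.nonneg_iff_isPositive P).2 hP
  have hs : IsSelfAdjoint (CFC.sqrt P) := (CFC.sqrt_nonneg P).isSelfAdjoint
  unfold traceSum hsSum
  congr 1; ext i
  have h1 : P (b i) = CFC.sqrt P (CFC.sqrt P (b i)) := by
    conv_lhs => rw [← CFC.sqrt_mul_sqrt_self P h0]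
    rfl
  have h2 : inner ℂ (b i) (P (b i)) = inner ℂ (CFC.sqrt P (b i)) (CFC.sqrt P (b i)) := by
    rw [h1, ← ContinuousLinearMap.adjoint_inner_left,
      (ContinuousLinearMap.isSelfAdjoint_iff'.1 hs)]
  rw [h2, inner_self_eq_norm_sq_to_K, ← ofReal_norm, ← ENNReal.ofReal_pow (norm_nonneg _)]
  norm_cast

/-- The trace of a positive operator may be computed in any orthonormal basis. -/
lemma posTrace_eq {ι : Type*} (b : HilbertBasis ι ℂ H) {P : H →L[ℂ] H} (hP : P.IsPositive) :
    posTrace P = traceSum b P := by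
  rw [posTrace, traceSum_eq_hsSum _ hP, traceSum_eq_hsSum _ hP, ← hsNormSq_eq b]; rfl

end BasisIndependence

/-! ### Unbounded operators -/

/-- The square `A²` of an unbounded operator, with domain `{φ ∈ D(A) | A φ ∈ D(A)}`. -/
def square (A : H →ₗ.[ℂ] H) : H →ₗ.[ℂ] H where
  domain :=
    { carrier := {φ | ∃ h : φ ∈ A.domain, A ⟨φ, h⟩ ∈ A.domain}
      zero_mem' := ⟨A.domain.zero_mem, by
        have h : A ⟨0, A.domain.zero_mem⟩ = 0 := A.map_zero
        rw [h]; exact A.domain.zero_mem⟩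
      add_mem' := by
        rintro φ ψ ⟨h, h'⟩ ⟨k, k'⟩
        refine ⟨A.domain.add_mem h k, ?_⟩
        have e : A ⟨φ + ψ, A.domain.add_mem h k⟩ = A ⟨φ, h⟩ + A ⟨ψ, k⟩ :=
          A.map_add ⟨φ, h⟩ ⟨ψ, k⟩
        rw [e]; exact A.domain.add_mem h' k'
      smul_mem' := by
        rintro c φ ⟨h, h'⟩
        refine ⟨A.domain.smul_mem c h, ?_⟩
        have e : A ⟨c • φ, A.domain.smul_mem c h⟩ = c • A ⟨φ, h⟩ := A.map_smul c ⟨φ, h⟩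
        rw [e]; exact A.domain.smul_mem c h' }
  toFun :=
    { toFun := fun φ => A ⟨A ⟨φ.1, φ.2.choose⟩, φ.2.choose_spec⟩
      map_add' := by
        rintro ⟨φ, h⟩ ⟨ψ, k⟩
        rw [← A.map_add]
        congr 2
        exact A.map_add ⟨φ, h.choose⟩ ⟨ψ, k.choose⟩
      map_smul' := by
        rintro c ⟨φ, h⟩
        rw [RingHom.id_apply, ← A.map_smul]
        congr 2
        exact A.map_smul c ⟨φ, h.choose⟩ }

/-- The product `S T` of a bounded operator `S` and an unbounded operator `T`, with the
domain of `T`. -/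
def mulUnbounded (S : H →L[ℂ] H) (T : H →ₗ.[ℂ] H) : H →ₗ.[ℂ] H :=
  S.toLinearMap.compPMap T

/-- The bounded operator `B`, defined on all of `H`, extends the unbounded operator `T`. -/
def Extends (B : H →L[ℂ] H) (T : H →ₗ.[ℂ] H) : Prop :=
  ∀ φ : T.domain, B φ = T φ

open scoped Classical in
/-- The extension of `T` to a bounded operator on `H` (it is unique if `T` is densely defined);
`0` if there is none. -/
def boundedExtension (T : H →ₗ.[ℂ] H) : H →L[ℂ] H :=
  if h : ∃ B : H →L[ℂ] H, Extends B T then h.choose else 0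

/-- `T` is square-summable with respect to `ρ`: the operator `√ρ T` extends to a
Hilbert-Schmidt operator. -/
def IsSquareSummable (T : H →ₗ.[ℂ] H) (ρ : H →L[ℂ] H) : Prop :=
  ∃ B : H →L[ℂ] H, Extends B (mulUnbounded (CFC.sqrt ρ) T) ∧ IsHilbertSchmidt B

/-- The bounded operator `√ρ T`, i.e. the bounded extension of the product of `√ρ` and `T`. -/
def sqrtMul (ρ : H →L[ℂ] H) (T : H →ₗ.[ℂ] H) : H →L[ℂ] H :=
  boundedExtension (mulUnbounded (CFC.sqrt ρ) T)

/-! ### The unitary group of a self-adjoint operator -/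

/-- `U` is a strongly continuous one-parameter unitary group, and its infinitesimal generator
is exactly `-i A` (with the same domain as `A`). -/
structure IsUnitaryGroupOf (A : H →ₗ.[ℂ] H) (U : ℝ → H →L[ℂ] H) : Prop where
  unitary : ∀ x, U x ∈ unitary (H →L[ℂ] H)
  map_zero : U 0 = 1
  map_add : ∀ x y, U (x + y) = U x * U y
  continuous : ∀ φ, Continuous fun x => U x φ
  generator : ∀ φ ψ, (φ, ψ) ∈ A.graph ↔ HasDerivAt (fun x => U x φ) (-(Complex.I • ψ)) 0

open scoped Classical in
/-- The unitary group `x ↦ e^{-iAx}` of a self-adjoint operator `A`: the one and only strongly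
continuous one-parameter unitary group with generator `-i A`. (For self-adjoint `A` this group
exists; the value `0` is used only for operators which generate no unitary group.) -/
def expNegI (A : H →ₗ.[ℂ] H) : ℝ → H →L[ℂ] H :=
  if h : ∃ U, IsUnitaryGroupOf A U then h.choose else 0

/-! ### The Gaussian semigroup and generators -/

/-- The Gaussian convolution semigroup
`ρ ↦ (2πt)^{-1/2} ∫ e^{-iAx} ρ e^{iAx} e^{-x²/(2t)} dx`, for `t > 0` and `ρ` of trace class
(the integrand is then a norm-continuous function of `x`). -/
def gaussianSemigroup (A : H →ₗ.[ℂ] H) (t : ℝ) (ρ : H →L[ℂ] H) : H →L[ℂ] H :=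
  (1 / √(2 * Real.pi * t)) •
    ∫ x : ℝ, Real.exp (-(x ^ 2 / (2 * t))) • (expNegI A x * ρ * expNegI A (-x))

/-- The difference quotient `t⁻¹ (Φ t ρ - ρ)` converges to `σ` in the trace norm as `t → 0+`. -/
def HasGeneratorValue (Φ : ℝ → (H →L[ℂ] H) → (H →L[ℂ] H)) (ρ σ : H →L[ℂ] H) : Prop :=
  Tendsto (fun t : ℝ => traceNorm (t⁻¹ • (Φ t ρ - ρ) - σ)) (𝓝[>] 0) (𝓝 0)

/-- The domain of the generator: all trace-class `ρ` for which the difference quotient converges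
in the Banach space of trace-class operators. -/
def generatorDomain (Φ : ℝ → (H →L[ℂ] H) → (H →L[ℂ] H)) : Set (H →L[ℂ] H) :=
  {ρ | IsTraceClass ρ ∧ ∃ σ, IsTraceClass σ ∧ HasGeneratorValue Φ ρ σ}

open scoped Classical in
/-- The generator: the limit of the difference quotient, for `ρ` in the domain (and `0`
elsewhere). -/
def generator (Φ : ℝ → (H →L[ℂ] H) → (H →L[ℂ] H)) (ρ : H →L[ℂ] H) : H →L[ℂ] H :=
  if h : ρ ∈ generatorDomain Φ then h.2.choose else 0

end GaussianSemigroup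

end

/-! Put `S = √ρ`, so that `ρ = S S*`, and let `B` be the Hilbert-Schmidt extension of `S A²`. Since
`A²` is self-adjoint (`mem_square_graph_of_forall_inner`), its adjoint `D = B*` equals `A² S` on all
of `H`: the range of `S` lies in the domain of `A²`. Hence `C = A S` is everywhere defined, and `‖C
ψ‖² = ⟨S ψ, D ψ⟩ ≤ ‖S ψ‖ ‖D ψ‖` makes it bounded and Hilbert-Schmidt (`exists_graph_clm`,
`isHilbertSchmidt_of_norm_sq_le`). Its adjoint extends `S A`, and the claimed value of the generator
becomes `σ = C C* - (D S* + S D*) / 2`.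

With `U x = e^{-iAx}`, Taylor's formula gives `U x S = S - i x C - x² D / 2 + r x`, where `r x` is
`o(x²)` in the Hilbert-Schmidt norm, by dominated convergence over a basis
(`exists_hsNormSq_taylorRemainder_le`). Multiplying by the adjoint, `U x ρ (U x)*` is `ρ` plus a
term linear in `x`, plus `x² σ`, plus a remainder of trace norm at most `ε x² + K x⁴` for every real
`x` (`exists_tracePairing_orbitRemainder_le`). Under the centred Gaussian of variance `t` the linear
term averages to zero, `x²` to `t` and `x⁴` to a multiple `m t²`, so the difference quotient is
within `ε + K m t` of `σ` (`hasGeneratorValue_mul_star`).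

Two tools support this. Stone's theorem is proved by Yosida approximation, so that `expNegI A` is a
genuine unitary group. Trace norms are bounded by duality, through finite sums of matrix
coefficients against contractions (`traceNorm_le_of_forall_tracePairing_le`). -/

namespace GaussianSemigroup

variable {H : Type*} [NormedAddCommGroup H] [InnerProductSpace ℂ H] [CompleteSpace H]

/-! ### Self-adjoint operators and their resolvents -/

section SelfAdjoint

variable {A : H →ₗ.[ℂ] H} (hA : IsSelfAdjoint A)
include hA

lemma inner_graph_symm {φ a ψ b : H} (h : (φ, a) ∈ A.graph) (k : (ψ, b) ∈ A.graph) :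
    inner ℂ a ψ = inner ℂ φ b := by
  rw [LinearPMap.mem_graph_iff] at h k
  obtain ⟨x, rfl, rfl⟩ := h
  obtain ⟨y, rfl, rfl⟩ := k
  have := LinearPMap.adjoint_isFormalAdjoint hA.dense_domain
  rw [LinearPMap.isSelfAdjoint_def.1 hA] at this
  exact this x y

/-- The inclusion of `A*` in `A`: a weak identity against the graph already yields membership in the
domain. -/
lemma mem_graph_of_forall_inner {y z : H}
    (h : ∀ φ a, (φ, a) ∈ A.graph → inner ℂ z φ = inner ℂ y a) : (y, z) ∈ A.graph := by
  have h' : ∀ x : A.domain, inner ℂ z (x : H) = inner ℂ y (A x) := fun x =>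
    h _ _ (A.mem_graph x)
  have hd := hA.dense_domain
  have hy : y ∈ A.adjoint.domain := LinearPMap.mem_adjoint_domain_of_exists y ⟨z, h'⟩
  have e := LinearPMap.adjoint_apply_eq hd ⟨y, hy⟩ h'
  have := A.adjoint.mem_graph ⟨y, hy⟩
  rw [e] at this
  change (y, z) ∈ A.adjoint.graph at this
  rwa [LinearPMap.isSelfAdjoint_def.1 hA] at this

lemma isClosed_graph : IsClosed (A.graph : Set (H × H)) := hA.isClosed

lemma inner_self_graph_im {φ a : H} (h : (φ, a) ∈ A.graph) : (inner ℂ a φ).im = 0 := by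
  have := inner_graph_symm hA h h
  rw [← inner_conj_symm φ a] at this
  exact Complex.conj_eq_iff_im.1 this.symm

/-- The cross term vanishes because `⟨a, φ⟩` is real; so `A + i l` is bounded below for either sign
of `l`. -/
lemma norm_add_smul_sq {φ a : H} (h : (φ, a) ∈ A.graph) (l : ℝ) :
    ‖a + (Complex.I * l) • φ‖ ^ 2 = ‖a‖ ^ 2 + l ^ 2 * ‖φ‖ ^ 2 := by
  have him := inner_self_graph_im hA h
  rw [@norm_add_sq ℂ, inner_smul_right, norm_smul]
  simp [him, mul_pow]

/-- On the complete graph of `A` the map `A + i l` is bounded below, so its range is closed. A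
vector `y` orthogonal to the range satisfies `A y = i l y`, which forces `y = 0` because `⟨A y, y⟩`
is real. -/
lemma exists_resolvent_vector {l : ℝ} (hl : l ≠ 0) (w : H) :
    ∃ φ, (φ, w - (Complex.I * l) • φ) ∈ A.graph := by
  let T : A.graph →L[ℂ] H :=
    (ContinuousLinearMap.snd ℂ H H + (Complex.I * (l : ℂ)) • ContinuousLinearMap.fst ℂ H H).comp
      A.graph.subtypeL
  have hT : ∀ x : A.graph, T x = x.1.2 + (Complex.I * l) • x.1.1 := fun x => rfl
  have : CompleteSpace A.graph := (isClosed_graph hA).completeSpace_coe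
  have hanti : ∃ K, AntilipschitzWith K T := by
    refine ⟨Real.toNNReal (1 + 1 / |l|), AddMonoidHomClass.antilipschitz_of_bound T fun x => ?_⟩
    have h := norm_add_smul_sq hA x.2 l
    rw [← hT] at h
    have hl' : 0 < |l| := abs_pos.2 hl
    rw [Real.coe_toNNReal _ (by positivity)]
    have h1 : ‖x.1.2‖ ≤ ‖T x‖ := by
      refine le_of_sq_le_sq ?_ (norm_nonneg _)
      nlinarith [mul_nonneg (sq_nonneg l) (sq_nonneg ‖x.1.1‖)]
    have h2 : |l| * ‖x.1.1‖ ≤ ‖T x‖ := by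
      refine le_of_sq_le_sq ?_ (norm_nonneg _)
      rw [mul_pow, sq_abs]
      nlinarith [sq_nonneg ‖x.1.2‖]
    have h3 : ‖x.1.1‖ ≤ 1 / |l| * ‖T x‖ := by
      rw [one_div, inv_mul_eq_div, le_div_iff₀ hl']; linarith
    have h4 : ‖x‖ = max ‖x.1.1‖ ‖x.1.2‖ := rfl
    rw [h4, max_le_iff, add_mul]
    have := norm_nonneg (T x)
    have : 0 ≤ 1 / |l| * ‖T x‖ := by positivity
    constructor <;> linarith
  obtain ⟨K, hK⟩ := hanti
  have hcl : IsClosed (Set.range T) := hK.isClosed_range T.uniformContinuous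
  have hcl' : IsClosed (T.range : Set H) := by
    convert hcl
    ext x; simp
  have hcomp : CompleteSpace T.range := hcl'.completeSpace_coe
  have htop : T.range = ⊤ := by
    rw [← Submodule.orthogonal_eq_bot_iff, Submodule.eq_bot_iff]
    intro y hy
    rw [Submodule.mem_orthogonal] at hy
    have hg : (y, (Complex.I * l) • y) ∈ A.graph := by
      refine mem_graph_of_forall_inner hA fun φ a hφ => ?_
      have := hy _ ⟨⟨(φ, a), hφ⟩, rfl⟩
      have e : inner ℂ y (a + (Complex.I * l) • φ) = 0 := by
        rw [← inner_conj_symm]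
        exact (map_eq_zero _).2 this
      rw [inner_add_right, inner_smul_right] at e
      rw [inner_smul_left]
      simp only [map_mul, Complex.conj_I, Complex.conj_ofReal]
      linear_combination -e
    have := inner_self_graph_im hA hg
    rw [inner_smul_left, inner_self_eq_norm_sq_to_K] at this
    simp [← Complex.ofReal_pow, hl] at this
    exact this
  have : w ∈ T.range := htop ▸ Submodule.mem_top
  obtain ⟨x, hx⟩ := this
  refine ⟨x.1.1, ?_⟩
  have e : w - (Complex.I * l) • x.1.1 = x.1.2 := by
    rw [← hx]
    change T x - _ = _
    rw [hT]; abel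
  rw [e]
  exact x.2

lemma abs_mul_norm_le {l : ℝ} {w φ : H} (h : (φ, w - (Complex.I * l) • φ) ∈ A.graph) :
    |l| * ‖φ‖ ≤ ‖w‖ := by
  have := norm_add_smul_sq hA h l
  rw [sub_add_cancel] at this
  refine le_of_sq_le_sq ?_ (norm_nonneg _)
  rw [mul_pow, sq_abs]
  nlinarith [sq_nonneg ‖w - (Complex.I * l) • φ‖]

lemma resolvent_unique {l : ℝ} (hl : l ≠ 0) {w φ ψ : H}
    (h : (φ, w - (Complex.I * l) • φ) ∈ A.graph) (k : (ψ, w - (Complex.I * l) • ψ) ∈ A.graph) :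
    φ = ψ := by
  have := A.graph.sub_mem h k
  have e : ((φ, w - (Complex.I * (l : ℂ)) • φ) - (ψ, w - (Complex.I * (l : ℂ)) • ψ) : H × H) =
      (φ - ψ, 0 - (Complex.I * (l : ℂ)) • (φ - ψ)) := by
    ext <;> simp [smul_sub]
  rw [e] at this
  have h2 := abs_mul_norm_le hA this
  have hl' : 0 < |l| := abs_pos.2 hl
  rw [norm_zero] at h2
  have : ‖φ - ψ‖ ≤ 0 := by
    by_contra h3
    push Not at h3
    nlinarith [mul_pos hl' h3]
  exact sub_eq_zero.1 (norm_le_zero_iff.1 this)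

lemma exists_resolvent (l : ℝ) (hl : l ≠ 0) :
    ∃ R : H →L[ℂ] H, ∀ w, (R w, w - (Complex.I * l) • R w) ∈ A.graph := by
  choose f hf using exists_resolvent_vector hA hl
  let F : H →ₗ[ℂ] H :=
    { toFun := f
      map_add' := fun x y => by
        refine resolvent_unique hA hl (hf _) ?_
        convert A.graph.add_mem (hf x) (hf y) using 1
        ext
        · rfl
        · simp only [smul_add, Prod.snd_add]; abel
      map_smul' := fun c x => by
        refine resolvent_unique hA hl (hf _) ?_
        convert A.graph.smul_mem c (hf x) using 1
        ext
        · rfl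
        · simp only [Prod.smul_snd, smul_sub, RingHom.id_apply]
          rw [smul_comm] }
  refine ⟨F.mkContinuous |l|⁻¹ fun x => ?_, fun w => hf w⟩
  have hl' : 0 < |l| := abs_pos.2 hl
  have := abs_mul_norm_le hA (hf x)
  rw [inv_mul_eq_div, le_div_iff₀ hl', mul_comm]
  exact this

end SelfAdjoint

/-- The resolvent `(A + i l)⁻¹` of a self-adjoint operator, for real `l ≠ 0`. -/
noncomputable def resolventI {A : H →ₗ.[ℂ] H} (hA : IsSelfAdjoint A) (l : ℝ) (hl : l ≠ 0) :
    H →L[ℂ] H := (exists_resolvent hA l hl).choose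

section Resolvent

variable {A : H →ₗ.[ℂ] H} (hA : IsSelfAdjoint A)

lemma resolventI_mem (l : ℝ) (hl : l ≠ 0) (w : H) :
    (resolventI hA l hl w, w - (Complex.I * l) • resolventI hA l hl w) ∈ A.graph :=
  (exists_resolvent hA l hl).choose_spec w

lemma resolventI_eq {l : ℝ} (hl : l ≠ 0) {w φ : H}
    (h : (φ, w - (Complex.I * l) • φ) ∈ A.graph) : resolventI hA l hl w = φ :=
  resolvent_unique hA hl (resolventI_mem hA l hl w) h

lemma resolventI_apply_graph {l : ℝ} (hl : l ≠ 0) {φ a : H} (h : (φ, a) ∈ A.graph) :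
    (Complex.I * l) • resolventI hA l hl φ = φ - resolventI hA l hl a := by
  have e : resolventI hA l hl (a + (Complex.I * l) • φ) = φ :=
    resolventI_eq hA hl (by rwa [add_sub_cancel_right])
  rw [map_add, map_smul] at e
  rw [eq_sub_iff_add_eq, add_comm]
  exact e

lemma norm_resolventI_le {l : ℝ} (hl : l ≠ 0) (w : H) :
    |l| * ‖resolventI hA l hl w‖ ≤ ‖w‖ :=
  abs_mul_norm_le hA (resolventI_mem hA l hl w)

lemma resolventI_comm {l m : ℝ} (hl : l ≠ 0) (hm : m ≠ 0) :
    Commute (resolventI hA l hl) (resolventI hA m hm) := by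
  ext w
  change resolventI hA l hl (resolventI hA m hm w) = resolventI hA m hm (resolventI hA l hl w)
  have h1 := resolventI_mem hA l hl w
  set u := resolventI hA l hl w
  have h2 := resolventI_mem hA m hm u
  set φ := resolventI hA m hm u
  -- The resolvent identity; applying `A + i l` to its right-hand factor then gives commutation.
  have h3 : resolventI hA m hm w = u + (Complex.I * (l - m)) • φ := by
    refine resolventI_eq hA hm ?_
    convert A.graph.add_mem h1 (A.graph.smul_mem (Complex.I * (l - m)) h2) using 1
    ext
    · rfl
    · simp only [Prod.smul_snd, Prod.snd_add]
      module
  refine resolventI_eq hA hl ?_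
  rw [h3]
  convert h2 using 2
  module

lemma inner_resolventI {l : ℝ} (hl : l ≠ 0) (w v : H) :
    inner ℂ (resolventI hA l hl w) v =
      inner ℂ w (resolventI hA (-l) (neg_ne_zero.2 hl) v) := by
  have h1 := resolventI_mem hA l hl w
  have h2 := resolventI_mem hA (-l) (neg_ne_zero.2 hl) v
  have := inner_graph_symm hA h1 h2
  simp only [inner_sub_left, inner_sub_right, inner_smul_left, inner_smul_right, map_mul,
    Complex.conj_I, Complex.conj_ofReal, Complex.ofReal_neg] at this
  linear_combination -this

/-- The vectors `i l (A + i l)⁻¹ φ`, with `l = s (n + 1)`, converge to `φ`. -/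
lemma tendsto_resolventI (s : ℝ) (hs : s ≠ 0) (φ : H) :
    Tendsto (fun n : ℕ => (Complex.I * ((s * (n + 1) : ℝ) : ℂ)) •
      resolventI hA (s * (n + 1)) (mul_ne_zero hs (by positivity)) φ) atTop (𝓝 φ) := by
  have hs' : 0 < |s| := abs_pos.2 hs
  rw [Metric.tendsto_atTop]
  intro ε hε
  obtain ⟨φ', hφ', hd⟩ := Metric.dense_iff.1 hA.dense_domain φ (ε / 3) (by positivity)
  rw [Metric.mem_ball, dist_eq_norm] at hφ'
  obtain ⟨a, ha⟩ := LinearPMap.mem_domain_iff.1 hd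
  obtain ⟨N, hN⟩ := exists_nat_gt (‖a‖ / (|s| * (ε / 3)))
  refine ⟨N, fun n hn => ?_⟩
  have hne : s * (n + 1) ≠ 0 := mul_ne_zero hs (by positivity)
  have habs : |s * (n + 1)| = |s| * (n + 1) := by
    rw [abs_mul, abs_of_pos (by positivity : (0 : ℝ) < n + 1)]
  set R := resolventI hA (s * (n + 1)) hne
  rw [dist_eq_norm]
  -- With `l = s (n + 1)`: on the domain `i l R φ' = φ' - R a` and `‖R a‖ ≤ ‖a‖ / |l|`, while `i l
  -- R` is a contraction and so preserves the error `φ - φ'`.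
  have e : (Complex.I * ((s * (n + 1) : ℝ) : ℂ)) • R φ - φ =
      (Complex.I * ((s * (n + 1) : ℝ) : ℂ)) • R (φ - φ') - R a + (φ' - φ) := by
    rw [map_sub, smul_sub, resolventI_apply_graph hA hne ha]; abel
  have h1 : ‖(Complex.I * ((s * (n + 1) : ℝ) : ℂ)) • R (φ - φ')‖ ≤ ‖φ' - φ‖ := by
    rw [norm_smul, norm_mul, Complex.norm_I, one_mul, Complex.norm_real, Real.norm_eq_abs,
      norm_sub_rev φ']
    exact norm_resolventI_le hA hne _
  have h2 : ‖R a‖ < ε / 3 := by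
    have h3 := norm_resolventI_le hA hne a
    rw [habs] at h3
    rw [div_lt_iff₀ (by positivity)] at hN
    have hn' : (N : ℝ) ≤ n := by exact_mod_cast hn
    have h4 : (N : ℝ) * (|s| * (ε / 3)) ≤ (n + 1) * (|s| * (ε / 3)) := by gcongr; linarith
    have h5 : (|s| * (n + 1)) * ‖R a‖ < (|s| * (n + 1)) * (ε / 3) := by
      change _ * ‖R a‖ ≤ _ at h3
      linarith
    exact lt_of_mul_lt_mul_left h5 (by positivity)
  rw [e]
  calc _ ≤ ‖(Complex.I * ((s * (n + 1) : ℝ) : ℂ)) • R (φ - φ')‖ + ‖R a‖ + ‖φ' - φ‖ :=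
        (norm_add_le _ _).trans (by gcongr; exact norm_sub_le _ _)
    _ < ε := by linarith

end Resolvent

/-! ### The square of a self-adjoint operator -/

omit [CompleteSpace H] in
lemma mem_square_graph_iff {A : H →ₗ.[ℂ] H} {φ b : H} :
    (φ, b) ∈ (square A).graph ↔ ∃ a, (φ, a) ∈ A.graph ∧ (a, b) ∈ A.graph := by
  constructor
  · intro h
    rw [LinearPMap.mem_graph_iff] at h
    obtain ⟨⟨y, hy⟩, rfl, rfl⟩ := h
    exact ⟨A ⟨y, hy.choose⟩, A.mem_graph ⟨y, _⟩, A.mem_graph ⟨_, hy.choose_spec⟩⟩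
  · rintro ⟨a, h1, h2⟩
    obtain ⟨⟨y, hy⟩, rfl, rfl⟩ := (LinearPMap.mem_graph_iff _).1 h1
    obtain ⟨⟨z, hz⟩, hz1, rfl⟩ := (LinearPMap.mem_graph_iff _).1 h2
    simp only at hz1
    subst hz1
    exact (LinearPMap.mem_graph_iff _).2 ⟨⟨y, ⟨hy, hz⟩⟩, rfl, rfl⟩

section Square

variable {A : H →ₗ.[ℂ] H} (hA : IsSelfAdjoint A)
include hA

/-- `1 + A² = (A - i)(A + i)` is inverted by two successive resolvents. -/
lemma exists_add_square_eq (w : H) :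
    ∃ φ a b, (φ, a) ∈ A.graph ∧ (a, b) ∈ A.graph ∧ φ + b = w := by
  have h1 := resolventI_mem hA (-1) (by norm_num) w
  set u := resolventI hA (-1) (by norm_num) w
  have h2 := resolventI_mem hA 1 (by norm_num) u
  set φ := resolventI hA 1 (by norm_num) u
  refine ⟨φ, _, w - φ, h2, ?_, by abel⟩
  convert A.graph.sub_mem h1 (A.graph.smul_mem (Complex.I * (1 : ℝ)) h2) using 1
  ext
  · rfl
  · simp only [Prod.smul_snd, Prod.snd_sub, smul_sub, smul_smul]
    have : Complex.I * ((1 : ℝ) : ℂ) * (Complex.I * ((1 : ℝ) : ℂ)) = -1 := by simp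
    rw [this]
    push_cast
    module

lemma inner_square_symm {φ b ψ d : H} (h : (φ, b) ∈ (square A).graph)
    (k : (ψ, d) ∈ (square A).graph) : inner ℂ b ψ = inner ℂ φ d := by
  obtain ⟨a, h1, h2⟩ := mem_square_graph_iff.1 h
  obtain ⟨c, k1, k2⟩ := mem_square_graph_iff.1 k
  rw [inner_graph_symm hA h2 k1, inner_graph_symm hA h1 k2]

/-- Self-adjointness of `A²`, from symmetry and surjectivity of `1 + A²`: if `φ + A² φ = y + z`,
then `y - φ` is orthogonal to the range of `1 + A²`, so `y = φ`. -/
lemma mem_square_graph_of_forall_inner {y z : H}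
    (h : ∀ φ b, (φ, b) ∈ (square A).graph → inner ℂ z φ = inner ℂ y b) :
    (y, z) ∈ (square A).graph := by
  obtain ⟨φ, a, b, h1, h2, e⟩ := exists_add_square_eq hA (y + z)
  have hφ : (φ, b) ∈ (square A).graph := mem_square_graph_iff.2 ⟨a, h1, h2⟩
  have hy : y = φ := by
    obtain ⟨ψ, c, d, k1, k2, e'⟩ := exists_add_square_eq hA (y - φ)
    have hψ : (ψ, d) ∈ (square A).graph := mem_square_graph_iff.2 ⟨c, k1, k2⟩
    have i1 := h _ _ hψ
    have i2 := inner_square_symm hA hφ hψ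
    have : inner ℂ (y - φ) (y - φ) = 0 := by
      calc inner ℂ (y - φ) (y - φ) = inner ℂ (y - φ) (ψ + d) := by rw [e']
        _ = inner ℂ y ψ + inner ℂ z ψ - (inner ℂ φ ψ + inner ℂ b ψ) := by
            rw [inner_add_right, inner_sub_left, inner_sub_left, i1, i2]; ring
        _ = inner ℂ (y + z) ψ - inner ℂ (φ + b) ψ := by rw [inner_add_left, inner_add_left]
        _ = 0 := by rw [e, sub_self]
    exact sub_eq_zero.1 (inner_self_eq_zero.1 this)
  subst hy
  have : z = b := (add_left_cancel e).symm
  rwa [this]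

/-- If `y = φ + A² φ` is orthogonal to the domain, then `0 = ⟨y, φ⟩ = ‖φ‖² + ‖A φ‖²`. -/
lemma dense_domain_square : Dense ((square A).domain : Set H) := by
  rw [Submodule.dense_iff_topologicalClosure_eq_top,
    Submodule.topologicalClosure_eq_top_iff, Submodule.eq_bot_iff]
  intro y hy
  rw [Submodule.mem_orthogonal'] at hy
  obtain ⟨φ, a, b, h1, h2, e⟩ := exists_add_square_eq hA y
  have hφ : φ ∈ (square A).domain :=
    LinearPMap.mem_domain_of_mem_graph (mem_square_graph_iff.2 ⟨a, h1, h2⟩)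
  have h := hy φ hφ
  rw [← e, inner_add_left, inner_graph_symm hA h2 h1, inner_self_eq_norm_sq_to_K,
    inner_self_eq_norm_sq_to_K] at h
  have h' : ‖φ‖ ^ 2 + ‖a‖ ^ 2 = 0 := by
    have := congrArg Complex.re h
    simpa [← Complex.ofReal_pow] using this
  have h3 : φ = 0 := by
    have : ‖φ‖ ^ 2 = 0 := by nlinarith [sq_nonneg ‖φ‖, sq_nonneg ‖a‖]
    simpa using this
  have h4 : a = 0 := by
    have : ‖a‖ ^ 2 = 0 := by nlinarith [sq_nonneg ‖φ‖, sq_nonneg ‖a‖]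
    simpa using this
  subst h4
  have h5 : b = 0 := LinearPMap.graph_fst_eq_zero_snd _ h2 rfl
  rw [← e, h3, h5, add_zero]

end Square

/-! ### Stone's theorem: a self-adjoint operator generates a unitary group -/

/-- The unitary group `x ↦ e^{-iPx}` of a bounded operator. -/
noncomputable def boundedGroup (P : H →L[ℂ] H) (x : ℝ) : H →L[ℂ] H :=
  NormedSpace.exp (x • (-(Complex.I • P)))

omit [CompleteSpace H] in
lemma hasDerivAt_of_map_add {U : ℝ → H →L[ℂ] H} (hU : ∀ x y, U (x + y) = U x * U y) {φ ψ : H}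
    (h0 : HasDerivAt (fun x => U x φ) ψ 0) (x : ℝ) : HasDerivAt (fun x => U x φ) (U x ψ) x := by
  have h1 : HasDerivAt (fun y : ℝ => U (y - x) φ) ψ x := by
    rw [← sub_self x] at h0
    exact h0.comp_sub_const x x
  have h2 := ((U x).restrictScalars ℝ).hasFDerivAt.comp_hasDerivAt x h1
  refine h2.congr_of_eventuallyEq (Eventually.of_forall fun y => ?_)
  change _ = (U x * U (y - x)) φ
  rw [← hU, add_sub_cancel]

/-! ### Unitary groups of bounded self-adjoint operators. -/

section BoundedGroup

lemma boundedGroup_zero (P : H →L[ℂ] H) : boundedGroup P 0 = 1 := by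
  simp [boundedGroup, NormedSpace.exp_zero]

lemma boundedGroup_add (P : H →L[ℂ] H) (x y : ℝ) :
    boundedGroup P (x + y) = boundedGroup P x * boundedGroup P y := by
  rw [boundedGroup, add_smul]
  let := NormedAlgebra.restrictScalars ℚ ℝ (H →L[ℂ] H)
  exact NormedSpace.exp_add_of_commute (((Commute.refl _).smul_left x).smul_right y)

lemma boundedGroup_add_of_commute {P Q : H →L[ℂ] H} (h : Commute P Q) (x : ℝ) :
    boundedGroup (P + Q) x = boundedGroup P x * boundedGroup Q x := by
  rw [boundedGroup, smul_add, neg_add, smul_add]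
  let := NormedAlgebra.restrictScalars ℚ ℝ (H →L[ℂ] H)
  exact NormedSpace.exp_add_of_commute
    ((((h.smul_left _).smul_right _).neg_left.neg_right.smul_left x).smul_right x)

lemma norm_boundedGroup_apply {P : H →L[ℂ] H} (hP : IsSelfAdjoint P) (x : ℝ) (φ : H) :
    ‖boundedGroup P x φ‖ = ‖φ‖ := by
  have hs : x • (-(Complex.I • P)) ∈ skewAdjoint (H →L[ℂ] H) := by
    refine skewAdjoint.smul_mem x ?_
    rw [skewAdjoint.mem_iff]
    simp [hP.star_eq]
  let := NormedAlgebra.restrictScalars ℚ ℝ (H →L[ℂ] H)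
  have hu := NormedSpace.exp_mem_unitary_of_mem_skewAdjoint hs
  exact (ContinuousLinearMap.norm_map_iff_adjoint_comp_self _).2 (Unitary.mem_iff.1 hu).1 φ

lemma hasDerivAt_boundedGroup (P : H →L[ℂ] H) (φ : H) (x : ℝ) :
    HasDerivAt (fun x => boundedGroup P x φ) (boundedGroup P x (-(Complex.I • P φ))) x := by
  have := hasDerivAt_exp_smul_const (𝕂 := ℝ) (-(Complex.I • P)) x
  exact (((ContinuousLinearMap.apply ℂ H φ).restrictScalars ℝ).hasFDerivAt.comp_hasDerivAt x this)

lemma norm_boundedGroup_sub_le {P : H →L[ℂ] H} (hP : IsSelfAdjoint P) (x : ℝ) (φ : H) :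
    ‖boundedGroup P x φ - φ‖ ≤ ‖P φ‖ * |x| := by
  have := Convex.norm_image_sub_le_of_norm_hasDerivWithin_le (𝕜 := ℝ) (C := ‖P φ‖)
    (fun y _ => (hasDerivAt_boundedGroup P φ y).hasDerivWithinAt) (fun y _ => by
      rw [norm_boundedGroup_apply hP, norm_neg, norm_smul, Complex.norm_I, one_mul])
    convex_univ (Set.mem_univ 0) (Set.mem_univ x)
  simpa [boundedGroup_zero] using this

/-- Commutation factors the difference through the group of `P - Q`. The bound involves only `(P -
Q) φ`, not the norms of `P` and `Q`, which may be unbounded along an approximating sequence. -/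
lemma norm_boundedGroup_sub_boundedGroup_le {P Q : H →L[ℂ] H} (hP : IsSelfAdjoint P)
    (hQ : IsSelfAdjoint Q) (h : Commute P Q) (x : ℝ) (φ : H) :
    ‖boundedGroup P x φ - boundedGroup Q x φ‖ ≤ ‖P φ - Q φ‖ * |x| := by
  have e : boundedGroup P x = boundedGroup Q x * boundedGroup (P - Q) x := by
    rw [← boundedGroup_add_of_commute (h.symm.sub_right (Commute.refl Q)), add_sub_cancel]
  have e' : boundedGroup P x φ - boundedGroup Q x φ =
      boundedGroup Q x (boundedGroup (P - Q) x φ - φ) := by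
    rw [e, map_sub]; rfl
  rw [e', norm_boundedGroup_apply hQ]
  exact norm_boundedGroup_sub_le (hP.sub hQ) x φ

end BoundedGroup

/-! ### Yosida approximation and its limiting group. -/

section Yosida

variable {A : H →ₗ.[ℂ] H} (hA : IsSelfAdjoint A)

/-- Bounded self-adjoint operators approximating a self-adjoint operator `A`. -/
noncomputable def yosida (n : ℕ) : H →L[ℂ] H :=
  (((n + 1 : ℝ) ^ 2 / 2 : ℝ) : ℂ) •
    (resolventI hA (1 * (n + 1)) (mul_ne_zero one_ne_zero (by positivity)) +
      resolventI hA (-1 * (n + 1)) (mul_ne_zero (by norm_num) (by positivity)))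

lemma resolventI_congr {l m : ℝ} (hl : l ≠ 0) (h : l = m) :
    resolventI hA l hl = resolventI hA m (h ▸ hl) := by
  subst h; rfl

lemma isSelfAdjoint_yosida (n : ℕ) : IsSelfAdjoint (yosida hA n) := by
  rw [ContinuousLinearMap.isSelfAdjoint_iff_isSymmetric]
  intro v w
  change inner ℂ (yosida hA n v) w = inner ℂ v (yosida hA n w)
  simp only [yosida, smul_apply, add_apply,
    inner_smul_left, inner_smul_right, inner_add_left, inner_add_right, Complex.conj_ofReal]
  rw [inner_resolventI, inner_resolventI,
    resolventI_congr hA (l := -(1 * ((n : ℝ) + 1))) (m := -1 * (n + 1)) _ (by ring),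
    resolventI_congr hA (l := -(-1 * ((n : ℝ) + 1))) (m := 1 * (n + 1)) _ (by ring)]
  ring

lemma yosida_comm (n m : ℕ) : Commute (yosida hA n) (yosida hA m) := by
  refine Commute.smul_left (Commute.smul_right ?_ _) _
  exact ((resolventI_comm hA _ _).add_right (resolventI_comm hA _ _)).add_left
    ((resolventI_comm hA _ _).add_right (resolventI_comm hA _ _))

/-- For `l = ±(n + 1)` and `R_l = (A + i l)⁻¹`, one has `i l R_l a = i l φ + l² R_l φ`. Averaging
over the two signs cancels the divergent term `i l φ` and leaves `yosida hA n φ`. -/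
lemma tendsto_yosida {φ a : H} (h : (φ, a) ∈ A.graph) :
    Tendsto (fun n => yosida hA n φ) atTop (𝓝 a) := by
  have h1 := tendsto_resolventI hA 1 one_ne_zero a
  have h2 := tendsto_resolventI hA (-1) (by norm_num) a
  have h3 := (h1.add h2).const_smul (1 / 2 : ℂ)
  have e : (1 / 2 : ℂ) • (a + a) = a := by module
  rw [e] at h3
  refine h3.congr fun n => ?_
  have hp : (n + 1 : ℝ) ≠ 0 := by positivity
  have h4 := resolventI_apply_graph hA (l := 1 * (n + 1)) (mul_ne_zero one_ne_zero hp) h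
  have h5 := resolventI_apply_graph hA (l := -1 * (n + 1)) (mul_ne_zero (by norm_num) hp) h
  rw [eq_sub_iff_add_eq, ← eq_sub_iff_add_eq'] at h4 h5
  rw [h4, h5]
  simp only [yosida, smul_apply, add_apply, smul_sub,
    smul_add, smul_smul]
  push_cast
  have hI : Complex.I * Complex.I = -1 := Complex.I_mul_I
  match_scalars
  · ring
  · linear_combination (-(1/2) * ((n:ℂ) + 1)^2) * hI
  · linear_combination (-(1/2) * ((n:ℂ) + 1)^2) * hI

include hA in
lemma exists_graph_norm_sub_lt (φ : H) {ε : ℝ} (hε : 0 < ε) :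
    ∃ φ' a, (φ', a) ∈ A.graph ∧ ‖φ' - φ‖ < ε := by
  obtain ⟨φ', hφ', hd⟩ := Metric.dense_iff.1 hA.dense_domain φ ε hε
  obtain ⟨a, ha⟩ := LinearPMap.mem_domain_iff.1 hd
  exact ⟨φ', a, ha, by rwa [Metric.mem_ball, dist_eq_norm] at hφ'⟩

lemma cauchySeq_yosidaGroup (x : ℝ) (φ : H) :
    CauchySeq fun n => boundedGroup (yosida hA n) x φ := by
  rw [Metric.cauchySeq_iff]
  intro ε hε
  obtain ⟨φ', a, ha, hφ'⟩ := exists_graph_norm_sub_lt hA φ (ε := ε / 3) (by positivity)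
  obtain ⟨N, hN⟩ := Metric.cauchySeq_iff.1 (tendsto_yosida hA ha).cauchySeq
    (ε / 3 / (|x| + 1)) (by positivity)
  refine ⟨N, fun m hm n hn => ?_⟩
  rw [dist_eq_norm]
  have h1 := norm_boundedGroup_sub_boundedGroup_le (isSelfAdjoint_yosida hA m)
    (isSelfAdjoint_yosida hA n) (yosida_comm hA m n) x φ'
  have h2 := hN m hm n hn
  rw [dist_eq_norm, lt_div_iff₀ (by positivity)] at h2
  have h3 : ‖yosida hA m φ' - yosida hA n φ'‖ * |x| < ε / 3 := by
    refine lt_of_le_of_lt ?_ h2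
    gcongr
    linarith
  have e : boundedGroup (yosida hA m) x φ - boundedGroup (yosida hA n) x φ =
      boundedGroup (yosida hA m) x (φ - φ') + (boundedGroup (yosida hA m) x φ' -
        boundedGroup (yosida hA n) x φ') + boundedGroup (yosida hA n) x (φ' - φ) := by
    rw [map_sub, map_sub]; abel
  have n1 := norm_boundedGroup_apply (isSelfAdjoint_yosida hA m) x (φ - φ')
  have n2 := norm_boundedGroup_apply (isSelfAdjoint_yosida hA n) x (φ' - φ)
  rw [norm_sub_rev φ φ'] at n1
  rw [e]
  refine (norm_add₃_le).trans_lt ?_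
  linarith

/-- The unitary group of `A`, as the limit of the groups of the approximating operators. -/
noncomputable def stoneGroup (x : ℝ) : H →L[ℂ] H :=
  continuousLinearMapOfTendsto (l := atTop) (fun n => boundedGroup (yosida hA n) x)
    (f := fun φ => (cauchySeq_tendsto_of_complete (cauchySeq_yosidaGroup hA x φ)).choose)
    (tendsto_pi_nhds.2 fun φ =>
      (cauchySeq_tendsto_of_complete (cauchySeq_yosidaGroup hA x φ)).choose_spec)

lemma tendsto_stoneGroup (x : ℝ) (φ : H) :
    Tendsto (fun n => boundedGroup (yosida hA n) x φ) atTop (𝓝 (stoneGroup hA x φ)) :=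
  (cauchySeq_tendsto_of_complete (cauchySeq_yosidaGroup hA x φ)).choose_spec

lemma norm_stoneGroup_apply (x : ℝ) (φ : H) : ‖stoneGroup hA x φ‖ = ‖φ‖ := by
  refine tendsto_nhds_unique (tendsto_stoneGroup hA x φ).norm ?_
  simp_rw [norm_boundedGroup_apply (isSelfAdjoint_yosida hA _)]
  exact tendsto_const_nhds

lemma stoneGroup_zero : stoneGroup hA 0 = 1 := by
  ext φ
  refine tendsto_nhds_unique (tendsto_stoneGroup hA 0 φ) ?_
  simp_rw [boundedGroup_zero]
  exact tendsto_const_nhds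

lemma stoneGroup_add (x y : ℝ) : stoneGroup hA (x + y) = stoneGroup hA x * stoneGroup hA y := by
  ext φ
  refine tendsto_nhds_unique (tendsto_stoneGroup hA (x + y) φ) ?_
  rw [mul_apply_eq_comp]
  have h1 := tendsto_stoneGroup hA x (stoneGroup hA y φ)
  have h2 := tendsto_iff_norm_sub_tendsto_zero.1 (tendsto_stoneGroup hA y φ)
  have h3 : Tendsto (fun n => boundedGroup (yosida hA n) x
      (boundedGroup (yosida hA n) y φ - stoneGroup hA y φ)) atTop (𝓝 0) := by
    rw [tendsto_zero_iff_norm_tendsto_zero]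
    simp_rw [norm_boundedGroup_apply (isSelfAdjoint_yosida hA _)]
    exact h2
  have h4 := h1.add h3
  rw [add_zero] at h4
  refine h4.congr fun n => ?_
  rw [boundedGroup_add, map_sub, add_sub_cancel, mul_apply_eq_comp]

/-- A bound linear in `|x|` with a factor tending to `0` in `n` carries the derivative at `0` over
to the limit group. -/
lemma norm_stoneGroup_sub_le {φ a : H} (h : (φ, a) ∈ A.graph) (n : ℕ) (x : ℝ) :
    ‖stoneGroup hA x φ - boundedGroup (yosida hA n) x φ‖ ≤ ‖a - yosida hA n φ‖ * |x| := by
  refine le_of_tendsto_of_tendsto ((tendsto_stoneGroup hA x φ).sub_const _).norm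
    (((tendsto_yosida hA h).sub_const (yosida hA n φ)).norm.mul_const |x|)
    (Eventually.of_forall fun m => ?_)
  exact norm_boundedGroup_sub_boundedGroup_le (isSelfAdjoint_yosida hA m)
    (isSelfAdjoint_yosida hA n) (yosida_comm hA m n) x φ

lemma hasDerivAt_stoneGroup_zero {φ a : H} (h : (φ, a) ∈ A.graph) :
    HasDerivAt (fun x => stoneGroup hA x φ) (-(Complex.I • a)) 0 := by
  rw [hasDerivAt_iff_isLittleO, Asymptotics.isLittleO_iff]
  intro ε hε
  obtain ⟨n, hn⟩ := ((Metric.tendsto_nhds.1 (tendsto_yosida hA h)) (ε / 3) (by positivity)).exists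
  rw [dist_eq_norm, norm_sub_rev] at hn
  have hb := hasDerivAt_boundedGroup (yosida hA n) φ 0
  rw [hasDerivAt_iff_isLittleO, Asymptotics.isLittleO_iff] at hb
  filter_upwards [hb (c := ε / 3) (by positivity)] with x hx
  have h1 := norm_stoneGroup_sub_le hA h n x
  simp only [sub_zero, stoneGroup_zero, boundedGroup_zero, one_apply_eq_self,
    Real.norm_eq_abs] at hx ⊢
  have e : stoneGroup hA x φ - φ - x • (-(Complex.I • a)) =
      (stoneGroup hA x φ - boundedGroup (yosida hA n) x φ) +
      (boundedGroup (yosida hA n) x φ - φ - x • (-(Complex.I • yosida hA n φ))) +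
      x • (Complex.I • (a - yosida hA n φ)) := by
    simp only [smul_sub, smul_neg]; abel
  have h2 : ‖x • (Complex.I • (a - yosida hA n φ))‖ = ‖a - yosida hA n φ‖ * |x| := by
    rw [norm_smul, norm_smul, Complex.norm_I, Real.norm_eq_abs]; ring
  have h3 : ‖a - yosida hA n φ‖ * |x| ≤ ε / 3 * |x| := by gcongr
  rw [e]
  refine (norm_add₃_le).trans ?_
  linarith

lemma hasDerivAt_stoneGroup {φ a : H} (h : (φ, a) ∈ A.graph) (x : ℝ) :
    HasDerivAt (fun x => stoneGroup hA x φ) (stoneGroup hA x (-(Complex.I • a))) x :=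
  hasDerivAt_of_map_add (stoneGroup_add hA) (hasDerivAt_stoneGroup_zero hA h) x

lemma continuous_stoneGroup (φ : H) : Continuous fun x => stoneGroup hA x φ := by
  refine continuous_of_uniform_approx_of_continuous fun u hu => ?_
  obtain ⟨ε, hε, hu⟩ := Metric.mem_uniformity_dist.1 hu
  obtain ⟨φ', a, ha, hφ'⟩ := exists_graph_norm_sub_lt hA φ hε
  refine ⟨fun x => stoneGroup hA x φ', ?_, fun x => hu ?_⟩
  · exact continuous_iff_continuousAt.2 fun x => (hasDerivAt_stoneGroup hA ha x).continuousAt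
  · rwa [dist_eq_norm, ← map_sub, norm_stoneGroup_apply, norm_sub_rev]

/-- **Stone's theorem** (existence of the unitary group). -/
theorem isUnitaryGroupOf_stoneGroup : IsUnitaryGroupOf A (stoneGroup hA) where
  unitary x := by
    have h1 : star (stoneGroup hA x) * stoneGroup hA x = 1 :=
      (ContinuousLinearMap.norm_map_iff_adjoint_comp_self _).1 (norm_stoneGroup_apply hA x)
    have h2 : stoneGroup hA x * stoneGroup hA (-x) = 1 := by
      rw [← stoneGroup_add, add_neg_cancel, stoneGroup_zero]
    refine Unitary.mem_iff.2 ⟨h1, ?_⟩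
    rw [left_inv_eq_right_inv h1 h2, h2]
  map_zero := stoneGroup_zero hA
  map_add := stoneGroup_add hA
  continuous := continuous_stoneGroup hA
  generator φ ψ := by
    refine ⟨hasDerivAt_stoneGroup_zero hA, fun h => ?_⟩
    -- The generator is no larger than `A`: differentiating `⟨U x φ, χ⟩ = ⟨φ, U (-x) χ⟩` at `0`
    -- tests `ψ` against every `χ` in the domain, and self-adjointness concludes.
    refine mem_graph_of_forall_inner hA fun χ c hχ => ?_
    have hk := hasDerivAt_stoneGroup_zero hA hχ
    have hkn : HasDerivAt (fun x : ℝ => stoneGroup hA (-x) χ) (Complex.I • c) 0 := by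
      rw [← neg_zero] at hk
      simpa [Function.comp_def] using hk.scomp (0 : ℝ) (hasDerivAt_neg 0)
    have d1 := h.inner ℂ (hasDerivAt_const (0 : ℝ) χ)
    have d2 := (hasDerivAt_const (0 : ℝ) φ).inner ℂ hkn
    have e : (fun x => inner ℂ (stoneGroup hA x φ) χ) =
        fun x => inner ℂ φ (stoneGroup hA (-x) χ) := by
      funext x
      rw [← (LinearMap.norm_map_iff_inner_map_map (stoneGroup hA x)).1
        (norm_stoneGroup_apply hA x) φ, ← mul_apply_eq_comp, ← stoneGroup_add,
        add_neg_cancel, stoneGroup_zero, one_apply_eq_self]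
    rw [e] at d1
    have := d1.unique d2
    simp only [inner_zero_left, inner_zero_right, inner_neg_left, inner_smul_left,
      inner_smul_right, Complex.conj_I, stoneGroup_zero, neg_zero,
      one_apply_eq_self, zero_add, add_zero] at this
    have hI : Complex.I ≠ 0 := Complex.I_ne_zero
    refine mul_left_cancel₀ hI ?_
    linear_combination this

/-- Existence rules out the default value `0` of `expNegI`. Uniqueness of the group is not needed,
as only these properties are used. -/
lemma isUnitaryGroupOf_expNegI (hA : IsSelfAdjoint A) : IsUnitaryGroupOf A (expNegI A) := by
  have h : ∃ U, IsUnitaryGroupOf A U := ⟨_, isUnitaryGroupOf_stoneGroup hA⟩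
  rw [expNegI, dif_pos h]
  exact h.choose_spec

end Yosida

/-! ### Estimates of the trace norm -/

lemma hsNormSq_star (T : H →L[ℂ] H) : hsNormSq (star T) = hsNormSq T :=
  (hsSum_adjoint (stdBasis H) (stdBasis H) T).symm

lemma hsNormSq_mul_le_of_contraction (T : H →L[ℂ] H) {W : H →L[ℂ] H} (hW : ‖W‖ ≤ 1) :
    hsNormSq (W * T) ≤ hsNormSq T := by
  refine ENNReal.tsum_le_tsum fun i => ?_
  gcongr
  rw [mul_apply_eq_comp, ← ofReal_norm, ← ofReal_norm]
  exact ENNReal.ofReal_le_ofReal (W.le_of_opNorm_le hW _ |>.trans_eq (one_mul _))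

lemma enorm_star_apply_sq_le (T : H →L[ℂ] H) (x : H) :
    ‖(star T) x‖ₑ ^ 2 ≤ hsNormSq T * ‖x‖ₑ ^ 2 := by
  rw [← parseval (stdBasis H), hsNormSq, hsSum, ← ENNReal.tsum_mul_right]
  refine ENNReal.tsum_le_tsum fun i => ?_
  rw [← mul_pow]
  gcongr
  rw [ContinuousLinearMap.star_eq_adjoint, ContinuousLinearMap.adjoint_inner_right,
    ← ofReal_norm, ← ofReal_norm, ← ofReal_norm, ← ENNReal.ofReal_mul (norm_nonneg _)]
  exact ENNReal.ofReal_le_ofReal (norm_inner_le_norm _ _)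

lemma isPositive_abs (T : H →L[ℂ] H) : (CFC.abs T).IsPositive :=
  (ContinuousLinearMap.nonneg_iff_isPositive _).1 (CFC.abs_nonneg T)

lemma norm_abs_apply (T : H →L[ℂ] H) (x : H) : ‖CFC.abs T x‖ = ‖T x‖ := by
  have h : CFC.abs T * CFC.abs T = star T * T := CFC.abs_mul_abs T
  have h1 : inner ℂ (CFC.abs T x) (CFC.abs T x) = inner ℂ (T x) (T x) := by
    calc inner ℂ (CFC.abs T x) (CFC.abs T x) = inner ℂ x ((CFC.abs T * CFC.abs T) x) :=
          (isPositive_abs T).1 x _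
      _ = inner ℂ (T x) (T x) := by
          rw [h, mul_apply_eq_comp, ContinuousLinearMap.star_eq_adjoint,
            ContinuousLinearMap.adjoint_inner_right]
  rw [inner_self_eq_norm_sq_to_K, inner_self_eq_norm_sq_to_K] at h1
  have h2 : ‖CFC.abs T x‖ ^ 2 = ‖T x‖ ^ 2 := by exact_mod_cast h1
  exact (pow_left_inj₀ (norm_nonneg _) (norm_nonneg _) two_ne_zero).1 h2

/-- The operator norm is bounded by the trace norm. -/
lemma enorm_apply_sq_le_traceNorm (T : H →L[ℂ] H) (x : H) :
    ‖T x‖ₑ ^ 2 ≤ traceNorm T ^ 2 * ‖x‖ₑ ^ 2 := by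
  set Q := CFC.sqrt (CFC.abs T) with hQ
  have hs : star Q = Q := (CFC.sqrt_nonneg (CFC.abs T)).isSelfAdjoint
  have h1 : traceNorm T = hsNormSq Q := traceSum_eq_hsSum _ (isPositive_abs T)
  have h2 : ‖T x‖ₑ = ‖Q (Q x)‖ₑ := by
    rw [← ofReal_norm, ← norm_abs_apply, ← CFC.sqrt_mul_sqrt_self (CFC.abs T) (CFC.abs_nonneg T),
      ofReal_norm]
    rfl
  have h3 := enorm_star_apply_sq_le Q (Q x)
  have h4 := enorm_star_apply_sq_le Q x
  rw [hs] at h3 h4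
  rw [h1, h2, pow_two (hsNormSq Q), mul_assoc]
  exact h3.trans (by gcongr)

/-- The sum `∑ i ∈ F, |⟪W bᵢ, T bᵢ⟫|` over finitely many vectors of the standard basis. -/
noncomputable def tracePairing (F : Finset (stdIndex H)) (W T : H →L[ℂ] H) : ℝ :=
  ∑ i ∈ F, ‖inner ℂ (W (stdBasis H i)) (T (stdBasis H i))‖

lemma norm_stdBasis (i : stdIndex H) : ‖stdBasis H i‖ = 1 := (stdBasis H).orthonormal.1 i

/-- `W = T (|T| + ε)⁻¹` is a regularised polar factor, replacing the partial isometry of the polar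
decomposition. The loss is `ε ⟨|T| (|T| + ε)⁻¹ e, e⟩`, at most `ε` in modulus. -/
lemma exists_contraction_re_inner_abs_le (T : H →L[ℂ] H) {ε : ℝ} (hε : 0 < ε) :
    ∃ W : H →L[ℂ] H, ‖W‖ ≤ 1 ∧ ∀ e : H, ‖e‖ = 1 →
      (inner ℂ e (CFC.abs T e)).re ≤ ‖inner ℂ (W e) (T e)‖ + ε := by
  set N := CFC.abs T with hN
  have hpos : N.IsPositive := isPositive_abs T
  have hunit : IsUnit (N + algebraMap ℝ (H →L[ℂ] H) ε) := by
    refine CStarAlgebra.isUnit_of_le (algebraMap ℝ (H →L[ℂ] H) ε) ?_ ?_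
    · exact le_add_of_nonneg_left (CFC.abs_nonneg T)
    · exact isStrictlyPositive_algebraMap hε
  obtain ⟨u, hu⟩ := hunit
  set R : H →L[ℂ] H := ↑u⁻¹ with hR
  have huv : ∀ y, N (R y) + (ε : ℂ) • R y = y := fun y => by
    have : (N + algebraMap ℝ (H →L[ℂ] H) ε) * R = 1 := by rw [← hu]; exact u.mul_inv
    have := congrArg (fun Z : H →L[ℂ] H => Z y) this
    simpa [Algebra.algebraMap_eq_smul_one] using this
  have hsym : ∀ x y, inner ℂ (N x) y = inner ℂ x (N y) := fun x y => hpos.1 x y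
  have hcontr : ∀ y, ‖N (R y)‖ ≤ ‖y‖ := fun y => by
    have h1 : ‖y‖ ^ 2 = ‖N (R y)‖ ^ 2 + 2 * (ε * (inner ℂ (N (R y)) (R y)).re) +
        ‖(ε : ℂ) • R y‖ ^ 2 := by
      conv_lhs => rw [← huv y]
      rw [@norm_add_sq ℂ, inner_smul_right]
      simp
    have h2 : 0 ≤ (inner ℂ (N (R y)) (R y)).re := hpos.2 (R y)
    refine le_of_sq_le_sq ?_ (norm_nonneg _)
    rw [h1]
    have : 0 ≤ ε * (inner ℂ (N (R y)) (R y)).re := by positivity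
    nlinarith [sq_nonneg ‖(ε : ℂ) • R y‖]
  refine ⟨T * R, ?_, fun e he => ?_⟩
  · refine ContinuousLinearMap.opNorm_le_bound _ zero_le_one fun y => ?_
    rw [one_mul, mul_apply_eq_comp, ← norm_abs_apply]
    exact hcontr y
  have h : N * N = star T * T := CFC.abs_mul_abs T
  have h1 : inner ℂ ((T * R) e) (T e) = inner ℂ (R e) (N (N e)) := by
    change inner ℂ (T (R e)) (T e) = inner ℂ (R e) ((N * N) e)
    rw [h, mul_apply_eq_comp, ContinuousLinearMap.star_eq_adjoint,
      ContinuousLinearMap.adjoint_inner_right]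
  have h2 : inner ℂ e (N e) = inner ℂ (R e) (N (N e)) + (ε : ℂ) * inner ℂ (N (R e)) e := by
    have h3 : inner ℂ e (N e) = inner ℂ (N (R e) + (ε : ℂ) • R e) (N e) := by rw [huv]
    rw [h3, inner_add_left, inner_smul_left, hsym, hsym, Complex.conj_ofReal]
  rw [h1, h2]
  refine (Complex.re_le_norm _).trans ((norm_add_le _ _).trans ?_)
  gcongr
  rw [norm_mul, Complex.norm_real, Real.norm_eq_abs, abs_of_pos hε]
  have h3 := (norm_inner_le_norm (𝕜 := ℂ) (N (R e)) e).trans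
    (mul_le_mul_of_nonneg_right (hcontr e) (norm_nonneg _))
  rw [he, one_mul] at h3
  nlinarith

/-- A bound for the trace norm by duality. -/
lemma traceNorm_le_of_forall_tracePairing_le {T : H →L[ℂ] H} {M : ℝ}
    (h : ∀ F W, ‖W‖ ≤ 1 → tracePairing F W T ≤ M) : traceNorm T ≤ ENNReal.ofReal M := by
  rw [traceNorm, posTrace, traceSum, ENNReal.tsum_eq_iSup_sum]
  refine iSup_le fun F => ?_
  have hp : ∀ i ∈ F, 0 ≤ (inner ℂ (stdBasis H i) (CFC.abs T (stdBasis H i))).re := fun i _ => by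
    exact (isPositive_abs T).re_inner_nonneg_right (stdBasis H i)
  rw [← ENNReal.ofReal_sum_of_nonneg hp]
  refine ENNReal.ofReal_le_ofReal (le_of_forall_pos_le_add fun ε hε => ?_)
  -- One contraction serves all vectors of `F`, so the error is shared among them; the `+ 1` allows
  -- `F` to be empty.
  obtain ⟨W, hW, hle⟩ := exists_contraction_re_inner_abs_le T
    (ε := ε / (F.card + 1)) (by positivity)
  calc _ ≤ ∑ i ∈ F, (‖inner ℂ (W (stdBasis H i)) (T (stdBasis H i))‖ + ε / (F.card + 1)) :=
        Finset.sum_le_sum fun i _ => hle _ (norm_stdBasis i)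
    _ = tracePairing F W T + F.card * (ε / (F.card + 1)) := by
        rw [Finset.sum_add_distrib, tracePairing, Finset.sum_const, nsmul_eq_mul]
    _ ≤ M + ε := by
        gcongr
        · exact h F W hW
        · rw [mul_div_assoc', div_le_iff₀ (by positivity)]
          nlinarith

section TracePairing

variable (F : Finset (stdIndex H)) (W : H →L[ℂ] H)

lemma tracePairing_add_le (T T' : H →L[ℂ] H) :
    tracePairing F W (T + T') ≤ tracePairing F W T + tracePairing F W T' := by
  rw [tracePairing, tracePairing, tracePairing, ← Finset.sum_add_distrib]
  refine Finset.sum_le_sum fun i _ => ?_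
  rw [add_apply, inner_add_right]
  exact norm_add_le _ _

lemma tracePairing_smul (c : ℂ) (T : H →L[ℂ] H) :
    tracePairing F W (c • T) = ‖c‖ * tracePairing F W T := by
  rw [tracePairing, tracePairing, Finset.mul_sum]
  refine Finset.sum_congr rfl fun i _ => ?_
  rw [smul_apply, inner_smul_right, norm_mul]

lemma tracePairing_sub_le (T T' : H →L[ℂ] H) :
    tracePairing F W (T - T') ≤ tracePairing F W T + tracePairing F W T' := by
  have h := tracePairing_add_le F W T ((-1 : ℂ) • T')
  rw [tracePairing_smul] at h
  simpa [sub_eq_add_neg] using h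

lemma sum_norm_sq_le {T : H →L[ℂ] H} {c : ℝ} (hT : hsNormSq T ≤ ENNReal.ofReal (c ^ 2)) :
    ∑ i ∈ F, ‖T (stdBasis H i)‖ ^ 2 ≤ c ^ 2 := by
  rw [← ENNReal.ofReal_le_ofReal_iff (sq_nonneg c),
    ENNReal.ofReal_sum_of_nonneg fun i _ => sq_nonneg _]
  refine le_trans ?_ hT
  rw [hsNormSq, hsSum]
  refine le_trans (le_of_eq ?_) (ENNReal.sum_le_tsum F)
  refine Finset.sum_congr rfl fun i _ => ?_
  rw [ENNReal.ofReal_pow (norm_nonneg _), ofReal_norm]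

/-- The trace norm of a product of two Hilbert-Schmidt operators is at most the product of the
Hilbert-Schmidt norms. -/
lemma tracePairing_mul_star_le {W : H →L[ℂ] H} (hW : ‖W‖ ≤ 1) {X Y : H →L[ℂ] H} {x y : ℝ}
    (hx : 0 ≤ x) (hy : 0 ≤ y) (hX : hsNormSq X ≤ ENNReal.ofReal (x ^ 2))
    (hY : hsNormSq Y ≤ ENNReal.ofReal (y ^ 2)) : tracePairing F W (X * star Y) ≤ x * y := by
  have hX' : hsNormSq (star X * W) ≤ ENNReal.ofReal (x ^ 2) := by
    rw [← hsNormSq_star, star_mul, star_star]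
    exact (hsNormSq_mul_le_of_contraction X (by rwa [norm_star])).trans hX
  have hY' : hsNormSq (star Y) ≤ ENNReal.ofReal (y ^ 2) := by rwa [hsNormSq_star]
  calc tracePairing F W (X * star Y)
      ≤ ∑ i ∈ F, ‖(star X * W) (stdBasis H i)‖ * ‖(star Y) (stdBasis H i)‖ := by
        refine Finset.sum_le_sum fun i _ => ?_
        rw [mul_apply_eq_comp, mul_apply_eq_comp, ← ContinuousLinearMap.adjoint_inner_left]
        exact norm_inner_le_norm _ _
    _ ≤ √(∑ i ∈ F, ‖(star X * W) (stdBasis H i)‖ ^ 2) *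
          √(∑ i ∈ F, ‖(star Y) (stdBasis H i)‖ ^ 2) := Real.sum_mul_le_sqrt_mul_sqrt _ _ _
    _ ≤ x * y := by
        gcongr
        · exact Real.sqrt_le_iff.2 ⟨hx, sum_norm_sq_le F hX'⟩
        · exact Real.sqrt_le_iff.2 ⟨hy, sum_norm_sq_le F hY'⟩

end TracePairing

/-! ### Second order expansion of the unitary group -/

section Taylor

variable {A : H →ₗ.[ℂ] H} {U : ℝ → H →L[ℂ] H} (hU : IsUnitaryGroupOf A U)
include hU

lemma IsUnitaryGroupOf.norm_apply (x : ℝ) (φ : H) : ‖U x φ‖ = ‖φ‖ :=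
  (ContinuousLinearMap.norm_map_iff_adjoint_comp_self _).2
    (Unitary.mem_iff.1 (hU.unitary x)).1 φ

lemma IsUnitaryGroupOf.star_eq (x : ℝ) : star (U x) = U (-x) := by
  have h1 := (Unitary.mem_iff.1 (hU.unitary x)).1
  have h2 : U x * U (-x) = 1 := by rw [← hU.map_add, add_neg_cancel, hU.map_zero]
  exact left_inv_eq_right_inv h1 h2

lemma IsUnitaryGroupOf.hasDerivAt {φ a : H} (h : (φ, a) ∈ A.graph) (x : ℝ) :
    HasDerivAt (fun x => U x φ) (U x (-(Complex.I • a))) x :=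
  hasDerivAt_of_map_add hU.map_add ((hU.generator φ a).1 h) x

/-- The mean value inequality is applied twice, without seeking the factor `1/2`. Leaving `M` free
allows `2 ‖b‖` for domination and a small constant near `0` for convergence. -/
lemma IsUnitaryGroupOf.norm_taylor_le {φ a b : H} (h : (φ, a) ∈ A.graph)
    (k : (a, b) ∈ A.graph) {x M : ℝ} (hM : ∀ s, |s| ≤ |x| → ‖U s b - b‖ ≤ M) :
    ‖U x φ - (φ - (Complex.I * x) • a - ((x : ℂ) ^ 2 / 2) • b)‖ ≤ M * x ^ 2 := by
  have hM0 : 0 ≤ M := (norm_nonneg _).trans (hM 0 (by simp))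
  have hofReal : ∀ s : ℝ, HasDerivAt (fun s : ℝ => (s : ℂ)) 1 s := fun s =>
    Complex.ofRealCLM.hasDerivAt
  have d1 : ∀ s : ℝ, HasDerivAt (fun s : ℝ => U s a - a + (Complex.I * s) • b)
      (-(Complex.I • (U s b - b))) s := fun s => by
    convert ((hU.hasDerivAt k s).sub_const a).add
      (((hofReal s).const_mul Complex.I).smul_const b) using 1
    · rfl
    · rw [map_neg, map_smul, mul_one, smul_sub]; abel
  have b1 : ∀ s, |s| ≤ |x| → ‖U s a - a + (Complex.I * s) • b‖ ≤ M * |x| := fun s hs => by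
    have hs' : s ∈ Set.Icc (-|x|) |x| := abs_le.1 hs
    have := Convex.norm_image_sub_le_of_norm_hasDerivWithin_le (𝕜 := ℝ) (C := M)
      (s := Set.Icc (-|x|) |x|) (fun y _ => (d1 y).hasDerivWithinAt) (fun y hy => by
        rw [norm_neg, norm_smul, Complex.norm_I, one_mul]
        exact hM y (abs_le.2 hy)) (convex_Icc _ _)
      (Set.mem_Icc.2 ⟨neg_nonpos.2 (abs_nonneg x), abs_nonneg x⟩) hs'
    simp only [hU.map_zero, one_apply_eq_self, sub_self, Complex.ofReal_zero, mul_zero, zero_smul,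
      add_zero, sub_zero, Real.norm_eq_abs] at this
    exact this.trans (by gcongr)
  have d2 : ∀ s : ℝ, HasDerivAt
      (fun s : ℝ => U s φ - (φ - (Complex.I * s) • a - ((s : ℂ) ^ 2 / 2) • b))
      (-(Complex.I • (U s a - a + (Complex.I * s) • b))) s := fun s => by
    convert (hU.hasDerivAt h s).sub
      (((((hofReal s).const_mul Complex.I).smul_const a).const_sub φ).sub
        ((((hofReal s).pow 2).div_const 2).smul_const b)) using 1
    · rfl
    · rw [map_neg, map_smul, smul_add, smul_sub, smul_smul, ← mul_assoc, Complex.I_mul_I]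
      simp only [mul_one, Nat.cast_ofNat, Nat.add_one_sub_one, pow_one]
      module
  have hx : x ∈ Set.Icc (-|x|) |x| := abs_le.1 le_rfl
  have := Convex.norm_image_sub_le_of_norm_hasDerivWithin_le (𝕜 := ℝ) (C := M * |x|)
    (s := Set.Icc (-|x|) |x|) (fun y _ => (d2 y).hasDerivWithinAt) (fun y hy => by
      rw [norm_neg, norm_smul, Complex.norm_I, one_mul]
      exact b1 y (abs_le.2 hy)) (convex_Icc _ _)
    (Set.mem_Icc.2 ⟨neg_nonpos.2 (abs_nonneg x), abs_nonneg x⟩) hx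
  simp only [hU.map_zero, one_apply_eq_self, Complex.ofReal_zero, mul_zero, zero_smul,
    sub_zero, Real.norm_eq_abs, zero_pow two_ne_zero, zero_div, sub_self] at this
  rwa [mul_assoc, ← abs_mul, abs_mul_self, ← pow_two] at this

end Taylor

lemma hsNormSq_unitaryGroup_mul_le {A : H →ₗ.[ℂ] H} {U : ℝ → H →L[ℂ] H}
    (hU : IsUnitaryGroupOf A U) (x : ℝ) (T : H →L[ℂ] H) : hsNormSq (U x * T) ≤ hsNormSq T :=
  hsNormSq_mul_le_of_contraction T
    (ContinuousLinearMap.opNorm_le_bound _ zero_le_one fun φ => by rw [hU.norm_apply, one_mul])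

/-- The remainder of second order of `e^{-iAx} S`, where `C = A S` and `D = A² S`. -/
noncomputable def taylorRemainder (U : ℝ → H →L[ℂ] H) (S C D : H →L[ℂ] H) (x : ℝ) : H →L[ℂ] H :=
  U x * S - (S - (Complex.I * x) • C - ((x : ℂ) ^ 2 / 2) • D)

section HilbertSchmidt

variable {A : H →ₗ.[ℂ] H} {U : ℝ → H →L[ℂ] H} (hU : IsUnitaryGroupOf A U)
  {S C D : H →L[ℂ] H} (hC : ∀ ψ, (S ψ, C ψ) ∈ A.graph) (hD : ∀ ψ, (C ψ, D ψ) ∈ A.graph)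
include hU hC hD

/-- The remainder is of size `o(x²)` in the Hilbert-Schmidt norm. -/
lemma exists_hsNormSq_taylorRemainder_le (hDs : IsHilbertSchmidt D) {η : ℝ} (hη : 0 < η) :
    ∃ δ > 0, ∀ x, |x| ≤ δ →
      hsNormSq (taylorRemainder U S C D x) ≤ ENNReal.ofReal ((η * x ^ 2) ^ 2) := by
  set b := stdBasis H
  have hr : ∀ x i, taylorRemainder U S C D x (b i) =
      U x (S (b i)) - (S (b i) - (Complex.I * x) • C (b i) - ((x : ℂ) ^ 2 / 2) • D (b i)) :=
    fun x i => rfl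
  -- Dominated convergence for `∑ g x i`: the majorant `(2 ‖D bᵢ‖)²` is summable, and strong
  -- continuity gives each limit. Division by zero makes `g 0 i = 0`, so the full filter `𝓝 0` can
  -- be used.
  let g : ℝ → stdIndex H → ℝ := fun x i => (‖taylorRemainder U S C D x (b i)‖ / x ^ 2) ^ 2
  have hsum : Summable fun i => (2 * ‖D (b i)‖) ^ 2 := by
    simp_rw [mul_pow]
    refine Summable.mul_left _ ?_
    have h1 : ∑' i, ‖D (b i)‖ₑ ^ 2 ≠ ∞ := hDs.ne
    refine (ENNReal.summable_toReal h1).congr fun i => ?_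
    rw [ENNReal.toReal_pow, toReal_enorm]
  have hbound : ∀ x i, g x i ≤ (2 * ‖D (b i)‖) ^ 2 := fun x i => by
    refine pow_le_pow_left₀ (by positivity) ?_ 2
    refine div_le_of_le_mul₀ (sq_nonneg x) (by positivity) ?_
    refine hU.norm_taylor_le (hC _) (hD _) fun s _ => ?_
    refine (norm_sub_le _ _).trans ?_
    rw [hU.norm_apply]; linarith
  have hlim : ∀ i, Tendsto (g · i) (𝓝 0) (𝓝 0) := fun i => by
    have h0 : Tendsto (fun x => ‖taylorRemainder U S C D x (b i)‖ / x ^ 2) (𝓝 0) (𝓝 0) := by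
      rw [Metric.tendsto_nhds]
      intro ε hε
      have hc : Tendsto (fun s => U s (D (b i))) (𝓝 0) (𝓝 (D (b i))) := by
        have := (hU.continuous (D (b i))).tendsto 0
        rwa [hU.map_zero] at this
      obtain ⟨δ, hδ, hs⟩ := Metric.tendsto_nhds_nhds.1 hc (ε / 2) (by positivity)
      filter_upwards [Metric.ball_mem_nhds (0 : ℝ) hδ] with x hx
      rw [Metric.mem_ball, Real.dist_eq, sub_zero] at hx
      rw [Real.dist_eq, sub_zero, abs_of_nonneg (by positivity)]
      refine lt_of_le_of_lt ?_ (half_lt_self hε)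
      refine div_le_of_le_mul₀ (sq_nonneg x) (by positivity) ?_
      refine hU.norm_taylor_le (hC _) (hD _) fun s hsx => ?_
      rw [← dist_eq_norm]
      exact (hs (by rw [Real.dist_eq, sub_zero]; exact hsx.trans_lt hx)).le
    simpa using h0.pow 2
  have ht := tendsto_tsum_of_dominated_convergence hsum hlim (Eventually.of_forall fun x i => by
    rw [Real.norm_eq_abs, abs_of_nonneg (sq_nonneg _)]; exact hbound x i)
  rw [tsum_zero] at ht
  obtain ⟨δ, hδ, h⟩ := Metric.tendsto_nhds_nhds.1 ht (η ^ 2) (by positivity)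
  refine ⟨δ / 2, half_pos hδ, fun x hx => ?_⟩
  rcases eq_or_ne x 0 with rfl | hx0
  · have : taylorRemainder U S C D 0 = 0 := by simp [taylorRemainder, hU.map_zero]
    rw [this]
    simp [hsNormSq, hsSum]
  have h1 := h (x := x) (by rw [Real.dist_eq, sub_zero]; linarith)
  rw [Real.dist_eq, sub_zero] at h1
  have hsg : Summable (g x) := hsum.of_nonneg_of_le (fun i => sq_nonneg _) (hbound x)
  have h2 : ∀ i, ‖taylorRemainder U S C D x (b i)‖ₑ ^ 2 = ENNReal.ofReal (x ^ 4 * g x i) := by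
    intro i
    rw [← ofReal_norm, ← ENNReal.ofReal_pow (norm_nonneg _)]
    congr 1
    simp only [g]
    field_simp
  rw [hsNormSq, hsSum, tsum_congr h2,
    ← ENNReal.ofReal_tsum_of_nonneg (fun i => by positivity) (hsg.mul_left _), tsum_mul_left]
  refine ENNReal.ofReal_le_ofReal ?_
  have h3 := (le_abs_self _).trans h1.le
  calc x ^ 4 * ∑' i, g x i ≤ x ^ 4 * η ^ 2 := by gcongr
    _ = (η * x ^ 2) ^ 2 := by ring

end HilbertSchmidt

/-- The remainder of second order of `x ↦ e^{-iAx} S S* e^{iAx}`, where `C = A S` and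
`D = A² S`. -/
noncomputable def orbitRemainder (U : ℝ → H →L[ℂ] H) (S C D : H →L[ℂ] H) (x : ℝ) : H →L[ℂ] H :=
  (U x * S) * star (U x * S) - S * star S
    - (x : ℂ) • (Complex.I • (S * star C) - Complex.I • (C * star S))
    - ((x : ℂ) ^ 2) • (C * star C - (1 / 2 : ℂ) • (D * star S + S * star D))

/-- With `P = U x S - r`, the product splits as `P P* + P r* + r (U x S)*`. The terms of `P P*` of
order at most two cancel; keeping `U x S` whole in the last term avoids a separate `r r*`. -/
lemma orbitRemainder_eq (U : ℝ → H →L[ℂ] H) (S C D : H →L[ℂ] H) (x : ℝ) :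
    orbitRemainder U S C D x =
      (Complex.I / 2 * (x : ℂ) ^ 3) • (C * star D) - (Complex.I / 2 * (x : ℂ) ^ 3) • (D * star C)
      + ((x : ℂ) ^ 4 / 4) • (D * star D)
      + (taylorRemainder U S C D x) * star (U x * S)
      + (S * star (taylorRemainder U S C D x)
        - (Complex.I * x) • (C * star (taylorRemainder U S C D x))
        - ((x : ℂ) ^ 2 / 2) • (D * star (taylorRemainder U S C D x))) := by
  set r := taylorRemainder U S C D x with hr
  have e : U x * S = S - (Complex.I * x) • C - ((x : ℂ) ^ 2 / 2) • D + r := by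
    rw [hr, taylorRemainder]; abel
  rw [orbitRemainder, e]
  simp only [star_add, star_sub, star_smul, mul_add, add_mul, mul_sub, sub_mul, smul_mul_assoc,
    mul_smul_comm, smul_smul, smul_sub, smul_add, star_mul', RCLike.star_def, map_div₀,
    map_pow, Complex.conj_I, Complex.conj_ofReal, map_ofNat]
  have hI : Complex.I * Complex.I = -1 := Complex.I_mul_I
  match_scalars <;> first | ring1 | linear_combination ((x:ℂ)^2) * hI | linear_combination (-(x:ℂ)^2) * hI

/-! ### Trace-norm bounds for the orbit remainder, near zero and globally. -/

section Estimate

variable {A : H →ₗ.[ℂ] H} {U : ℝ → H →L[ℂ] H} (hU : IsUnitaryGroupOf A U)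
  {S C D : H →L[ℂ] H} {s c d : ℝ} (hs0 : 0 ≤ s) (hc0 : 0 ≤ c) (hd0 : 0 ≤ d)
  (hs : hsNormSq S ≤ ENNReal.ofReal (s ^ 2)) (hc : hsNormSq C ≤ ENNReal.ofReal (c ^ 2))
  (hd : hsNormSq D ≤ ENNReal.ofReal (d ^ 2))
include hs0 hc0 hd0 hs hc hd

lemma tracePairing_generatorValue_le (F : Finset (stdIndex H)) {W : H →L[ℂ] H} (hW : ‖W‖ ≤ 1) :
    tracePairing F W (C * star C - (1 / 2 : ℂ) • (D * star S + S * star D)) ≤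
      c * c + d * s := by
  have h1 := tracePairing_mul_star_le F hW hc0 hc0 hc hc
  have h2 := tracePairing_mul_star_le F hW hd0 hs0 hd hs
  have h3 := tracePairing_mul_star_le F hW hs0 hd0 hs hd
  have h4 := tracePairing_sub_le F W (C * star C) ((1 / 2 : ℂ) • (D * star S + S * star D))
  have h5 := tracePairing_add_le F W (D * star S) (S * star D)
  rw [tracePairing_smul, show ‖(1 / 2 : ℂ)‖ = 1 / 2 by norm_num] at h4
  linarith

include hU

lemma tracePairing_orbitRemainder_le_global (F : Finset (stdIndex H)) {W : H →L[ℂ] H}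
    (hW : ‖W‖ ≤ 1) (x : ℝ) :
    tracePairing F W (orbitRemainder U S C D x) ≤
      2 * (s * s) + |x| * (2 * (s * c)) + x ^ 2 * (c * c + d * s) := by
  have hus := (hsNormSq_unitaryGroup_mul_le hU x S).trans hs
  have h0 := tracePairing_generatorValue_le hs0 hc0 hd0 hs hc hd F hW
  have h1 := tracePairing_mul_star_le F hW hs0 hs0 hus hus
  have h2 := tracePairing_mul_star_le F hW hs0 hs0 hs hs
  have h3 := tracePairing_mul_star_le F hW hs0 hc0 hs hc
  have h4 := tracePairing_mul_star_le F hW hc0 hs0 hc hs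
  rw [orbitRemainder]
  refine (tracePairing_sub_le _ _ _ _).trans ?_
  refine (add_le_add_left (tracePairing_sub_le _ _ _ _) _).trans ?_
  refine (add_le_add_left (add_le_add_left (tracePairing_sub_le _ _ _ _) _) _).trans ?_
  have h5 := tracePairing_sub_le F W (Complex.I • (S * star C)) (Complex.I • (C * star S))
  rw [tracePairing_smul, tracePairing_smul, Complex.norm_I, one_mul, one_mul] at h5
  rw [tracePairing_smul, tracePairing_smul, norm_pow, Complex.norm_real, Real.norm_eq_abs, sq_abs]
  have h6 := mul_le_mul_of_nonneg_left (h5.trans (add_le_add h3 h4)) (abs_nonneg x)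
  have h7 := mul_le_mul_of_nonneg_left h0 (sq_nonneg x)
  linarith

lemma tracePairing_orbitRemainder_le_of_hsNormSq_le (F : Finset (stdIndex H)) {W : H →L[ℂ] H}
    (hW : ‖W‖ ≤ 1) {x q : ℝ} (hq : 0 ≤ q)
    (hr : hsNormSq (taylorRemainder U S C D x) ≤ ENNReal.ofReal (q ^ 2)) :
    tracePairing F W (orbitRemainder U S C D x) ≤
      |x| ^ 3 * (c * d) + x ^ 4 * (d * d) + q * (2 * s + |x| * c + x ^ 2 * d) := by
  have hus := (hsNormSq_unitaryGroup_mul_le hU x S).trans hs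
  have h1 := tracePairing_mul_star_le F hW hc0 hd0 hc hd
  have h2 := tracePairing_mul_star_le F hW hd0 hc0 hd hc
  have h3 := tracePairing_mul_star_le F hW hd0 hd0 hd hd
  have h4 := tracePairing_mul_star_le F hW hq hs0 hr hus
  have h5 := tracePairing_mul_star_le F hW hs0 hq hs hr
  have h6 := tracePairing_mul_star_le F hW hc0 hq hc hr
  have h7 := tracePairing_mul_star_le F hW hd0 hq hd hr
  rw [orbitRemainder_eq]
  refine (tracePairing_add_le _ _ _ _).trans ?_
  refine (add_le_add (tracePairing_add_le _ _ _ _) (tracePairing_sub_le _ _ _ _)).trans ?_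
  refine (add_le_add (add_le_add_left (tracePairing_add_le _ _ _ _) _)
    (add_le_add_left (tracePairing_sub_le _ _ _ _) _)).trans ?_
  refine (add_le_add_left (add_le_add_left (add_le_add_left
    (tracePairing_sub_le _ _ _ _) _) _) _).trans ?_
  simp only [tracePairing_smul, norm_mul, norm_div, norm_pow, Complex.norm_real,
    Real.norm_eq_abs, Complex.norm_I, one_mul, RCLike.norm_ofNat, sq_abs]
  have e4 : |x| ^ 4 = x ^ 4 := by rw [← abs_pow, abs_of_nonneg (by positivity)]
  rw [e4]
  have a0 := abs_nonneg x
  have k1 := mul_le_mul_of_nonneg_left h1 (by positivity : 0 ≤ 1 / 2 * |x| ^ 3)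
  have k2 := mul_le_mul_of_nonneg_left h2 (by positivity : 0 ≤ 1 / 2 * |x| ^ 3)
  have k3 := mul_le_mul_of_nonneg_left h3 (by positivity : 0 ≤ x ^ 4 / 4)
  have k6 := mul_le_mul_of_nonneg_left h6 a0
  have k7 := mul_le_mul_of_nonneg_left h7 (by positivity : 0 ≤ x ^ 2 / 2)
  have p1 : 0 ≤ x ^ 4 * (d * d) := by positivity
  have p2 : 0 ≤ q * (x ^ 2 * d) := by positivity
  linarith

/-- The trace norm of the remainder is at most `ε x² + K x⁴`. -/
lemma exists_tracePairing_orbitRemainder_le (hC : ∀ ψ, (S ψ, C ψ) ∈ A.graph)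
    (hD : ∀ ψ, (C ψ, D ψ) ∈ A.graph) {ε : ℝ} (hε : 0 < ε) :
    ∃ K, 0 ≤ K ∧ ∀ F W x, ‖W‖ ≤ 1 →
      tracePairing F W (orbitRemainder U S C D x) ≤ ε * x ^ 2 + K * x ^ 4 := by
  -- The sum of the coefficients in the bound near zero, each of which will carry a factor `ε / m *
  -- x ^ 2`; the `+ 1` makes it positive.
  set m := c * d + d * d + (2 * s + c + d) + 1 with hm
  have hm0 : 0 < m := by positivity
  obtain ⟨δ', hδ', hr⟩ := exists_hsNormSq_taylorRemainder_le hU hC hD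
    (hd.trans_lt ENNReal.ofReal_lt_top) (η := ε / m) (by positivity)
  set δ := min δ' (min 1 (ε / m)) with hδ
  have hδ0 : 0 < δ := lt_min hδ' (lt_min one_pos (by positivity))
  -- For `|x| > δ` the powers `1`, `|x|`, `x²` are at most `x⁴ / δ⁴`, `x⁴ / δ³`, `x⁴ / δ²`, so the
  -- whole global bound is absorbed by `K x⁴`.
  set K := 2 * (s * s) / δ ^ 4 + 2 * (s * c) / δ ^ 3 + (c * c + d * s) / δ ^ 2 with hK
  have hK0 : 0 ≤ K := by positivity
  refine ⟨K, hK0, fun F W x hW => ?_⟩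
  have a0 := abs_nonneg x
  rcases le_or_gt |x| δ with hx | hx
  · have hx1 : |x| ≤ 1 := hx.trans ((min_le_right _ _).trans (min_le_left _ _))
    have hx2 : |x| ≤ ε / m := hx.trans ((min_le_right _ _).trans (min_le_right _ _))
    have h := tracePairing_orbitRemainder_le_of_hsNormSq_le hU hs0 hc0 hd0 hs hc hd F hW
      (q := ε / m * x ^ 2) (by positivity) (hr x (hx.trans (min_le_left _ _)))
    have e2 : x ^ 2 = |x| ^ 2 := (sq_abs x).symm
    have hx3 : |x| ^ 2 ≤ 1 := pow_le_one₀ a0 hx1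
    have t1 : |x| ^ 3 * (c * d) ≤ ε / m * x ^ 2 * (c * d) := by
      have : |x| ^ 3 = |x| * x ^ 2 := by rw [e2]; ring
      rw [this]; gcongr
    have t2 : x ^ 4 * (d * d) ≤ ε / m * x ^ 2 * (d * d) := by
      have : x ^ 4 = (|x| * |x|) * x ^ 2 := by rw [← pow_two, sq_abs]; ring
      rw [this]
      have : |x| * |x| ≤ ε / m := by nlinarith
      gcongr
    have t3 : ε / m * x ^ 2 * (2 * s + |x| * c + x ^ 2 * d) ≤
        ε / m * x ^ 2 * (2 * s + c + d) := by
      have u1 : |x| * c ≤ c := mul_le_of_le_one_left hc0 hx1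
      have u2 : x ^ 2 * d ≤ d := mul_le_of_le_one_left hd0 (by rw [e2]; exact hx3)
      gcongr
    have t4 : ε / m * x ^ 2 * m = ε * x ^ 2 := by field_simp
    have t5 : 0 ≤ ε / m * x ^ 2 := by positivity
    have t6 : 0 ≤ K * x ^ 4 := by positivity
    have t7 : ε / m * x ^ 2 * (c * d + d * d + (2 * s + c + d)) ≤ ε * x ^ 2 := by
      rw [← t4, hm]
      exact mul_le_mul_of_nonneg_left (by linarith) t5
    linarith
  · have h := tracePairing_orbitRemainder_le_global hU hs0 hc0 hd0 hs hc hd F hW x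
    have hx0 : 0 < |x| := hδ0.trans hx
    have e4 : x ^ 4 = |x| ^ 4 := by rw [← abs_pow, abs_of_nonneg (by positivity)]
    have e2 : x ^ 2 = |x| ^ 2 := (sq_abs x).symm
    have v1 : 2 * (s * s) ≤ 2 * (s * s) / δ ^ 4 * x ^ 4 := by
      rw [div_mul_eq_mul_div, le_div_iff₀ (by positivity), e4]; gcongr
    have v2 : |x| * (2 * (s * c)) ≤ 2 * (s * c) / δ ^ 3 * x ^ 4 := by
      rw [div_mul_eq_mul_div, le_div_iff₀ (by positivity), e4]
      calc |x| * (2 * (s * c)) * δ ^ 3 ≤ |x| * (2 * (s * c)) * |x| ^ 3 := by gcongr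
        _ = _ := by ring
    have v3 : x ^ 2 * (c * c + d * s) ≤ (c * c + d * s) / δ ^ 2 * x ^ 4 := by
      rw [div_mul_eq_mul_div, le_div_iff₀ (by positivity), e4, e2]
      calc |x| ^ 2 * (c * c + d * s) * δ ^ 2 ≤ |x| ^ 2 * (c * c + d * s) * |x| ^ 2 := by gcongr
        _ = _ := by ring
    have v4 : 0 ≤ ε * x ^ 2 := by positivity
    rw [hK, add_mul, add_mul]
    linarith

end Estimate

/-! ### Gaussian averages -/

section Gaussian

open ProbabilityTheory

lemma integrable_pow_gaussianReal (v : ℝ≥0) (n : ℕ) :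
    Integrable (fun x : ℝ => x ^ n) (gaussianReal 0 v) := by
  have h := (memLp_id_gaussianReal' (μ := 0) (v := v) n (by simp)).integrable_norm_pow'
  refine h.mono' (by fun_prop) (Eventually.of_forall fun x => ?_)
  simp

lemma integral_sq_gaussianReal (v : ℝ≥0) : ∫ x, x ^ 2 ∂(gaussianReal 0 v) = v := by
  have h := variance_fun_id_gaussianReal (μ := 0) (v := v)
  rw [variance_eq_integral measurable_id'.aemeasurable] at h
  simpa using h

/-- Scaling from variance one: only the order `v²` matters, not the value of the moment. -/
lemma integral_pow_four_gaussianReal (v : ℝ≥0) :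
    ∫ x, x ^ 4 ∂(gaussianReal 0 v) = v ^ 2 * ∫ x, x ^ 4 ∂(gaussianReal 0 1) := by
  have h : gaussianReal 0 v = (gaussianReal 0 1).map (√(v : ℝ) * ·) := by
    rw [gaussianReal_map_const_mul, mul_zero, mul_one]
    congr 1
    ext
    exact (Real.sq_sqrt v.2).symm
  rw [h, integral_map (by fun_prop) (by fun_prop), ← integral_const_mul]
  congr 1
  ext x
  rw [mul_pow, show (4 : ℕ) = 2 * 2 by rfl, pow_mul √(v : ℝ), Real.sq_sqrt v.coe_nonneg]

lemma gaussianSemigroup_eq_integral (A : H →ₗ.[ℂ] H) {t : ℝ} (ht : 0 < t) (ρ : H →L[ℂ] H) :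
    gaussianSemigroup A t ρ =
      ∫ x, expNegI A x * ρ * expNegI A (-x) ∂(gaussianReal 0 t.toNNReal) := by
  rw [integral_gaussianReal_eq_integral_smul (by simpa using ht), gaussianSemigroup,
    ← integral_smul]
  congr 1
  ext1 x
  rw [smul_smul, gaussianPDFReal, Real.coe_toNNReal _ ht.le, sub_zero, one_div, neg_div]

/-- The Bochner integral is taken in operator norm, yet trace-norm bounds pass through it, since a
finite pairing only involves bounded functionals. -/
lemma tracePairing_integral_le {μ : Measure ℝ} {R : ℝ → H →L[ℂ] H} (hR : Integrable R μ)
    (F : Finset (stdIndex H)) (W : H →L[ℂ] H) {g : ℝ → ℝ} (hg : Integrable g μ)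
    (h : ∀ x, tracePairing F W (R x) ≤ g x) :
    tracePairing F W (∫ x, R x ∂μ) ≤ ∫ x, g x ∂μ := by
  let L : stdIndex H → (H →L[ℂ] H) →L[ℂ] ℂ := fun i =>
    (innerSL ℂ (W (stdBasis H i))).comp (ContinuousLinearMap.apply ℂ H (stdBasis H i))
  have hL : ∀ i T, inner ℂ (W (stdBasis H i)) (T (stdBasis H i)) = L i T := fun i T => rfl
  have hi : ∀ i, Integrable (fun x => ‖L i (R x)‖) μ := fun i => ((L i).integrable_comp hR).norm
  simp only [tracePairing, hL] at h ⊢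
  calc ∑ i ∈ F, ‖L i (∫ x, R x ∂μ)‖ ≤ ∑ i ∈ F, ∫ x, ‖L i (R x)‖ ∂μ := by
        refine Finset.sum_le_sum fun i _ => ?_
        rw [← (L i).integral_comp_comm hR]
        exact norm_integral_le_integral_norm _
    _ = ∫ x, ∑ i ∈ F, ‖L i (R x)‖ ∂μ := (integral_finsetSum _ fun i _ => hi i).symm
    _ ≤ ∫ x, g x ∂μ := integral_mono (integrable_finsetSum _ fun i _ => hi i) hg h

/-! ### Gaussian averages of the orbit in operator norm. -/

section Average

variable {A : H →ₗ.[ℂ] H} {U : ℝ → H →L[ℂ] H} (hU : IsUnitaryGroupOf A U)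
  {S C : H →L[ℂ] H} (hC : ∀ ψ, (S ψ, C ψ) ∈ A.graph)
include hU hC

/-- The group itself is only strongly continuous, but boundedness of `C = A S` makes `U x * S`
Lipschitz in operator norm, as Bochner integrability of the orbit requires. -/
lemma continuous_unitaryGroup_mul : Continuous fun x => U x * S := by
  refine LipschitzWith.continuous (K := ‖C‖₊) (LipschitzWith.of_dist_le_mul fun x y => ?_)
  rw [dist_eq_norm, dist_eq_norm]
  refine ContinuousLinearMap.opNorm_le_bound _ (by positivity) fun ψ => ?_
  have := Convex.norm_image_sub_le_of_norm_hasDerivWithin_le (𝕜 := ℝ) (C := ‖C‖ * ‖ψ‖)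
    (fun z _ => (hU.hasDerivAt (hC ψ) z).hasDerivWithinAt) (fun z _ => by
      rw [hU.norm_apply, norm_neg, norm_smul, Complex.norm_I, one_mul]
      exact C.le_opNorm ψ) convex_univ (Set.mem_univ y) (Set.mem_univ x)
  calc _ ≤ ‖C‖ * ‖ψ‖ * ‖x - y‖ := this
    _ = _ := by rw [coe_nnnorm]; ring

lemma integrable_orbit (μ : Measure ℝ) [IsFiniteMeasure μ] :
    Integrable (fun x => (U x * S) * star (U x * S)) μ := by
  have hc := continuous_unitaryGroup_mul hU hC
  refine Integrable.of_bound (C := ‖S‖ * ‖S‖) (hc.mul hc.star).aestronglyMeasurable ?_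
  refine Eventually.of_forall fun x => ?_
  have h1 : ‖U x * S‖ ≤ ‖S‖ := ContinuousLinearMap.opNorm_le_bound _ (norm_nonneg _) fun ψ => by
    rw [mul_apply_eq_comp, hU.norm_apply]; exact S.le_opNorm ψ
  refine (norm_mul_le _ _).trans ?_
  rw [norm_star]
  gcongr

lemma integral_orbitRemainder (D : H →L[ℂ] H) (v : ℝ≥0) :
    Integrable (orbitRemainder U S C D) (gaussianReal 0 v) ∧
    ∫ x, orbitRemainder U S C D x ∂(gaussianReal 0 v) =
      ∫ x, (U x * S) * star (U x * S) ∂(gaussianReal 0 v) - S * star S -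
        (v : ℂ) • (C * star C - (1 / 2 : ℂ) • (D * star S + S * star D)) := by
  have h0 := integrable_orbit hU hC (gaussianReal 0 v)
  have h1 : Integrable (fun x : ℝ => (x : ℂ)) (gaussianReal 0 v) := by
    simpa using (integrable_pow_gaussianReal v 1).ofReal (𝕜 := ℂ)
  have h2 : Integrable (fun x : ℝ => (x : ℂ) ^ 2) (gaussianReal 0 v) := by
    simpa using (integrable_pow_gaussianReal v 2).ofReal (𝕜 := ℂ)
  have i1 : ∫ x : ℝ, (x : ℂ) ∂(gaussianReal 0 v) = 0 := by
    have := integral_ofReal (𝕜 := ℂ) (μ := gaussianReal 0 v) (f := fun x => x)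
    rw [integral_id_gaussianReal] at this
    simpa using this
  have i2 : ∫ x : ℝ, (x : ℂ) ^ 2 ∂(gaussianReal 0 v) = v := by
    have := integral_ofReal (𝕜 := ℂ) (μ := gaussianReal 0 v) (f := fun x => x ^ 2)
    rw [integral_sq_gaussianReal] at this
    simpa using this
  have k1 := h0.sub (integrable_const (S * star S))
  have k2 := k1.sub (h1.smul_const (Complex.I • (S * star C) - Complex.I • (C * star S)))
  have k3 := h2.smul_const (C * star C - (1 / 2 : ℂ) • (D * star S + S * star D))
  refine ⟨k2.sub k3, ?_⟩
  refine (integral_sub k2 k3).trans ?_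
  rw [integral_smul_const, i2]
  congr 1
  refine (integral_sub k1 (h1.smul_const _)).trans ?_
  rw [integral_smul_const, i1, zero_smul, sub_zero]
  refine (integral_sub h0 (integrable_const _)).trans ?_
  rw [integral_const]
  simp

end Average

/-- The generator on an operator `S S*` for which the range of `S` is contained in the domain
of `A²`, and `S`, `A S`, `A² S` are Hilbert-Schmidt. -/
theorem hasGeneratorValue_mul_star {A : H →ₗ.[ℂ] H} (hA : IsSelfAdjoint A) {S C D : H →L[ℂ] H}
    (hC : ∀ ψ, (S ψ, C ψ) ∈ A.graph) (hD : ∀ ψ, (C ψ, D ψ) ∈ A.graph) {s c d : ℝ}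
    (hs0 : 0 ≤ s) (hc0 : 0 ≤ c) (hd0 : 0 ≤ d)
    (hs : hsNormSq S ≤ ENNReal.ofReal (s ^ 2)) (hc : hsNormSq C ≤ ENNReal.ofReal (c ^ 2))
    (hd : hsNormSq D ≤ ENNReal.ofReal (d ^ 2)) :
    HasGeneratorValue (gaussianSemigroup A) (S * star S)
      (C * star C - (1 / 2 : ℂ) • (D * star S + S * star D)) := by
  have hU := isUnitaryGroupOf_expNegI hA
  set U := expNegI A
  set σ := C * star C - (1 / 2 : ℂ) • (D * star S + S * star D)
  set m := ∫ x : ℝ, x ^ 4 ∂(gaussianReal 0 1)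
  -- `K` depends on `ε` but not on `t`, so `ε` is fixed before letting `t` tend to `0`.
  have key : ∀ ε : ℝ, 0 < ε → ∃ K, 0 ≤ K ∧ ∀ t : ℝ, 0 < t →
      traceNorm (t⁻¹ • (gaussianSemigroup A t (S * star S) - S * star S) - σ) ≤
        ENNReal.ofReal (ε + K * m * t) := fun ε hε => by
    obtain ⟨K, hK0, hK⟩ :=
      exists_tracePairing_orbitRemainder_le hU hs0 hc0 hd0 hs hc hd hC hD hε
    refine ⟨K, hK0, fun t ht => traceNorm_le_of_forall_tracePairing_le fun F W hW => ?_⟩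
    obtain ⟨hint, heq⟩ := integral_orbitRemainder hU hC D t.toNNReal
    have e1 : ∀ x, U x * (S * star S) * U (-x) = (U x * S) * star (U x * S) := fun x => by
      rw [star_mul, hU.star_eq]; noncomm_ring
    have e2 : t⁻¹ • (gaussianSemigroup A t (S * star S) - S * star S) - σ =
        ((t⁻¹ : ℝ) : ℂ) • ∫ x, orbitRemainder U S C D x ∂(gaussianReal 0 t.toNNReal) := by
      rw [gaussianSemigroup_eq_integral A ht, heq]
      simp only [← e1]
      rw [smul_sub _ _ (((t.toNNReal : ℝ) : ℂ) • σ), smul_smul, Real.coe_toNNReal _ ht.le,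
        ← Complex.ofReal_mul, inv_mul_cancel₀ ht.ne', Complex.ofReal_one, one_smul]
      rfl
    have j2 := integrable_pow_gaussianReal t.toNNReal 2
    have j4 := integrable_pow_gaussianReal t.toNNReal 4
    have hle := tracePairing_integral_le hint F W ((j2.const_mul ε).add (j4.const_mul K))
      fun x => hK F W x hW
    have hval : ∫ x, ((fun x : ℝ => ε * x ^ 2) + fun x : ℝ => K * x ^ 4) x ∂(gaussianReal 0 t.toNNReal) =
        ε * t + K * (t ^ 2 * m) := by
      refine (integral_add (j2.const_mul ε) (j4.const_mul K)).trans ?_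
      rw [integral_const_mul, integral_const_mul, integral_sq_gaussianReal,
        integral_pow_four_gaussianReal, Real.coe_toNNReal _ ht.le]
    rw [hval] at hle
    rw [e2, tracePairing_smul, Complex.norm_real, Real.norm_eq_abs, abs_of_pos (inv_pos.2 ht)]
    calc _ ≤ t⁻¹ * (ε * t + K * (t ^ 2 * m)) := by gcongr
      _ = ε + K * m * t := by field_simp
  rw [HasGeneratorValue, ENNReal.tendsto_nhds_zero]
  intro ε hε
  rcases eq_or_ne ε ∞ with rfl | hεt
  · exact Eventually.of_forall fun _ => le_top
  have hε' : 0 < ε.toReal := ENNReal.toReal_pos hε.ne' hεt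
  obtain ⟨K, -, hK⟩ := key (ε.toReal / 2) (by positivity)
  have hlim : Tendsto (fun t : ℝ => ε.toReal / 2 + K * m * t) (𝓝[>] 0) (𝓝 (ε.toReal / 2)) := by
    have : Continuous fun t : ℝ => ε.toReal / 2 + K * m * t := by fun_prop
    have h := (this.tendsto 0).mono_left (nhdsWithin_le_nhds (s := Set.Ioi 0))
    simpa using h
  filter_upwards [hlim.eventually (gt_mem_nhds (half_lt_self hε')), self_mem_nhdsWithin]
    with t h1 h2
  refine (hK t h2).trans ?_
  exact (ENNReal.ofReal_le_ofReal h1.le).trans_eq (ENNReal.ofReal_toReal hεt)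

end Gaussian

/-! ### The domain and the values of the generator -/

/-- The trace norm dominates the operator norm, so both limits agree on each vector. This identifies
the value chosen by `generator`. -/
lemma HasGeneratorValue.unique {Φ : ℝ → (H →L[ℂ] H) → (H →L[ℂ] H)} {ρ σ τ : H →L[ℂ] H}
    (h : HasGeneratorValue Φ ρ σ) (k : HasGeneratorValue Φ ρ τ) : σ = τ := by
  have key : ∀ {σ : H →L[ℂ] H}, HasGeneratorValue Φ ρ σ → ∀ x,
      Tendsto (fun t : ℝ => (t⁻¹ • (Φ t ρ - ρ)) x) (𝓝[>] 0) (𝓝 (σ x)) := fun {σ} h x => by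
    have h1 : Tendsto (fun t : ℝ => traceNorm (t⁻¹ • (Φ t ρ - ρ) - σ) ^ 2 * ‖x‖ₑ ^ 2)
        (𝓝[>] 0) (𝓝 0) := by
      have h3 := ENNReal.Tendsto.pow (n := 2) h
      have h2 := ENNReal.Tendsto.mul_const (b := ‖x‖ₑ ^ 2) h3
        (Or.inr (ENNReal.pow_ne_top enorm_ne_top))
      simpa using h2
    have h2 : Tendsto (fun t : ℝ => ‖(t⁻¹ • (Φ t ρ - ρ) - σ) x‖ₑ ^ 2) (𝓝[>] 0) (𝓝 0) :=
      tendsto_of_tendsto_of_tendsto_of_le_of_le tendsto_const_nhds h1 (fun _ => zero_le)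
        fun t => enorm_apply_sq_le_traceNorm _ x
    have h3 := (ENNReal.tendsto_toReal ENNReal.zero_ne_top).comp h2
    have h4 := h3.sqrt
    rw [tendsto_iff_norm_sub_tendsto_zero]
    simpa [Function.comp_def, Real.sqrt_sq] using h4
  ext x
  exact tendsto_nhds_unique (key h x) (key k x)

lemma generator_eq {Φ : ℝ → (H →L[ℂ] H) → (H →L[ℂ] H)} {ρ σ : H →L[ℂ] H}
    (hρ : ρ ∈ generatorDomain Φ) (h : HasGeneratorValue Φ ρ σ) : generator Φ ρ = σ := by
  rw [generator, dif_pos hρ]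
  exact hρ.2.choose_spec.2.unique h

omit [CompleteSpace H] in
lemma boundedExtension_eq {T : H →ₗ.[ℂ] H} (hT : Dense (T.domain : Set H)) {B : H →L[ℂ] H}
    (hB : Extends B T) : boundedExtension T = B := by
  have h : ∃ B : H →L[ℂ] H, Extends B T := ⟨B, hB⟩
  rw [boundedExtension, dif_pos h]
  refine ContinuousLinearMap.coeFn_injective ?_
  refine Continuous.ext_on hT (ContinuousLinearMap.continuous _) B.continuous fun φ hφ => ?_
  exact (h.choose_spec ⟨φ, hφ⟩).trans (hB ⟨φ, hφ⟩).symm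

/-- If `D = A² S` on all of `H`, then `A S` is everywhere defined and bounded. -/
lemma exists_graph_clm {A : H →ₗ.[ℂ] H} (hA : IsSelfAdjoint A) {S D : H →L[ℂ] H}
    (hD : ∀ ψ, (S ψ, D ψ) ∈ (square A).graph) :
    ∃ C : H →L[ℂ] H, (∀ ψ, (S ψ, C ψ) ∈ A.graph) ∧ (∀ ψ, (C ψ, D ψ) ∈ A.graph) ∧
      ∀ ψ, ‖C ψ‖ ^ 2 ≤ ‖S ψ‖ * ‖D ψ‖ := by
  choose f hf1 hf2 using fun ψ => mem_square_graph_iff.1 (hD ψ)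
  -- Symmetry of `A` gives `⟨A S ψ, A S ψ⟩ = ⟨S ψ, A² S ψ⟩`, followed by Cauchy-Schwarz.
  have hsq : ∀ ψ, ‖f ψ‖ ^ 2 ≤ ‖S ψ‖ * ‖D ψ‖ := fun ψ => by
    have h := inner_graph_symm hA (hf1 ψ) (hf2 ψ)
    rw [inner_self_eq_norm_sq_to_K] at h
    have h2 := norm_inner_le_norm (𝕜 := ℂ) (S ψ) (D ψ)
    rw [← h] at h2
    simpa using h2
  let C : H →ₗ[ℂ] H :=
    { toFun := f
      map_add' := fun x y => by
        have := A.graph.add_mem (hf1 x) (hf1 y)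
        exact LinearPMap.mem_graph_snd_inj _ (hf1 _) this (map_add S x y)
      map_smul' := fun c x => by
        have := A.graph.smul_mem c (hf1 x)
        exact LinearPMap.mem_graph_snd_inj _ (hf1 _) this (map_smul S c x) }
  refine ⟨C.mkContinuous (‖S‖ + ‖D‖) fun ψ => ?_, hf1, hf2, hsq⟩
  refine le_of_sq_le_sq ((hsq ψ).trans ?_) (by positivity)
  calc ‖S ψ‖ * ‖D ψ‖ ≤ (‖S‖ * ‖ψ‖) * (‖D‖ * ‖ψ‖) := by
        gcongr
        · exact S.le_opNorm ψ
        · exact D.le_opNorm ψ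
    _ = ‖S‖ * ‖D‖ * ‖ψ‖ ^ 2 := by ring
    _ ≤ (‖S‖ + ‖D‖) ^ 2 * ‖ψ‖ ^ 2 := by
        gcongr
        nlinarith [norm_nonneg S, norm_nonneg D, mul_nonneg (norm_nonneg S) (norm_nonneg D)]
    _ = ((‖S‖ + ‖D‖) * ‖ψ‖) ^ 2 := by ring

lemma isHilbertSchmidt_of_norm_sq_le {S C D : H →L[ℂ] H} (hS : IsHilbertSchmidt S)
    (hD : IsHilbertSchmidt D) (h : ∀ ψ, ‖C ψ‖ ^ 2 ≤ ‖S ψ‖ * ‖D ψ‖) : IsHilbertSchmidt C := by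
  refine lt_of_le_of_lt ?_ (ENNReal.add_lt_top.2 ⟨hS, hD⟩)
  rw [hsNormSq, hsNormSq, hsNormSq, hsSum, hsSum, hsSum, ← ENNReal.tsum_add]
  refine ENNReal.tsum_le_tsum fun i => ?_
  simp only [← ofReal_norm]
  rw [← ENNReal.ofReal_pow (norm_nonneg _), ← ENNReal.ofReal_pow (norm_nonneg _),
    ← ENNReal.ofReal_pow (norm_nonneg _), ← ENNReal.ofReal_add (sq_nonneg _) (sq_nonneg _)]
  refine ENNReal.ofReal_le_ofReal ((h _).trans ?_)
  nlinarith [sq_nonneg (‖S (stdBasis H i)‖ - ‖D (stdBasis H i)‖),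
    sq_nonneg ‖S (stdBasis H i)‖, sq_nonneg ‖D (stdBasis H i)‖]

lemma hsNormSq_le_ofReal_sqrt_sq {T : H →L[ℂ] H} (hT : IsHilbertSchmidt T) :
    hsNormSq T ≤ ENNReal.ofReal (√(hsNormSq T).toReal ^ 2) := by
  rw [Real.sq_sqrt ENNReal.toReal_nonneg, ENNReal.ofReal_toReal hT.ne]

lemma extends_star_mulUnbounded {T : H →ₗ.[ℂ] H} {S C : H →L[ℂ] H} (hS : star S = S)
    (h : ∀ φ a ψ, (φ, a) ∈ T.graph → inner ℂ (C ψ) φ = inner ℂ (S ψ) a) :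
    Extends (star C) (mulUnbounded S T) := fun φ => by
  refine ext_inner_left ℂ fun ψ => ?_
  rw [ContinuousLinearMap.star_eq_adjoint, ContinuousLinearMap.adjoint_inner_right,
    h _ _ ψ (T.mem_graph φ), ← hS, ContinuousLinearMap.star_eq_adjoint,
    ContinuousLinearMap.adjoint_inner_left, ← ContinuousLinearMap.star_eq_adjoint, hS]
  rfl

end GaussianSemigroup

/-! ### The generator on states with square-summable `A²`. -/

open GaussianSemigroup in
theorem mainTheorem8 {H : Type*} [NormedAddCommGroup H] [InnerProductSpace ℂ H] [CompleteSpace H]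
    (A : H →ₗ.[ℂ] H) (hA : IsSelfAdjoint A)
    (ρ : H →L[ℂ] H) (hρ : IsState ρ) (hAρ : IsSquareSummable (square A) ρ) :
    IsSquareSummable A ρ ∧
      ρ ∈ generatorDomain (gaussianSemigroup A) ∧
      generator (gaussianSemigroup A) ρ =
        star (sqrtMul ρ A) * sqrtMul ρ A -
          (1 / 2 : ℂ) • (star (sqrtMul ρ (square A)) * CFC.sqrt ρ +
            CFC.sqrt ρ * sqrtMul ρ (square A)) := by
  obtain ⟨B, hBext, hBhs⟩ := hAρ
  have hρ0 : 0 ≤ ρ := (ContinuousLinearMap.nonneg_iff_isPositive ρ).2 hρ.1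
  have hSS : CFC.sqrt ρ * CFC.sqrt ρ = ρ := CFC.sqrt_mul_sqrt_self ρ hρ0
  have hSsq : sqrtMul ρ (square A) = B :=
    boundedExtension_eq (T := mulUnbounded (CFC.sqrt ρ) (square A)) (dense_domain_square hA) hBext
  have hShs : IsHilbertSchmidt (CFC.sqrt ρ) := by
    have : hsNormSq (CFC.sqrt ρ) = posTrace ρ := (traceSum_eq_hsSum _ hρ.1).symm
    rw [IsHilbertSchmidt, this, hρ.2]
    exact ENNReal.one_lt_top
  rw [hSsq]
  have hρtr : IsTraceClass ρ := by
    rw [IsTraceClass, traceNorm, CFC.abs_of_nonneg ρ hρ0, hρ.2]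
    exact ENNReal.one_lt_top
  have hSA : sqrtMul ρ A = boundedExtension (mulUnbounded (CFC.sqrt ρ) A) := rfl
  rw [hSA, IsSquareSummable]
  have hSstar : star (CFC.sqrt ρ) = CFC.sqrt ρ := (CFC.sqrt_nonneg ρ).isSelfAdjoint
  generalize CFC.sqrt ρ = S at *
  -- For `φ` in the domain of `A²`, `⟨B* ψ, φ⟩ = ⟨ψ, S A² φ⟩ = ⟨S ψ, A² φ⟩`; self-adjointness of
  -- `A²` turns this into `B* = A² S` everywhere.
  have hDsq : ∀ ψ, (S ψ, star B ψ) ∈ (square A).graph := fun ψ => by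
    refine mem_square_graph_of_forall_inner hA fun φ b hφ => ?_
    obtain ⟨x, rfl, rfl⟩ := (LinearPMap.mem_graph_iff _).1 hφ
    rw [ContinuousLinearMap.star_eq_adjoint, ContinuousLinearMap.adjoint_inner_left, hBext x,
      ← hSstar, ContinuousLinearMap.star_eq_adjoint, ContinuousLinearMap.adjoint_inner_left,
      ← ContinuousLinearMap.star_eq_adjoint, hSstar]
    rfl
  have hDhs : IsHilbertSchmidt (star B) := by rwa [IsHilbertSchmidt, hsNormSq_star]
  obtain ⟨C, hC, hD, hCsq⟩ := exists_graph_clm hA hDsq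
  have hChs : IsHilbertSchmidt C := isHilbertSchmidt_of_norm_sq_le hShs hDhs hCsq
  have hCext : Extends (star C) (mulUnbounded S A) :=
    extends_star_mulUnbounded hSstar fun φ a ψ h => inner_graph_symm hA (hC ψ) h
  rw [boundedExtension_eq (T := mulUnbounded S A) hA.dense_domain hCext]
  have hs := hsNormSq_le_ofReal_sqrt_sq hShs
  have hc := hsNormSq_le_ofReal_sqrt_sq hChs
  have hd := hsNormSq_le_ofReal_sqrt_sq hDhs
  have hgen := hasGeneratorValue_mul_star hA hC hD (Real.sqrt_nonneg _) (Real.sqrt_nonneg _)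
    (Real.sqrt_nonneg _) hs hc hd
  have hσ : IsTraceClass (C * star C - (1 / 2 : ℂ) • (star B * star S + S * star (star B))) :=
    (traceNorm_le_of_forall_tracePairing_le fun F W hW =>
      tracePairing_generatorValue_le (Real.sqrt_nonneg _) (Real.sqrt_nonneg _)
        (Real.sqrt_nonneg _) hs hc hd F hW).trans_lt ENNReal.ofReal_lt_top
  rw [hSstar, hSS, star_star] at hgen
  rw [hSstar, star_star] at hσ
  have hdom : ρ ∈ generatorDomain (gaussianSemigroup A) := ⟨hρtr, _, hσ, hgen⟩
  refine ⟨⟨star C, hCext, by rwa [IsHilbertSchmidt, hsNormSq_star]⟩, hdom, ?_⟩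
  rw [generator_eq hdom hgen, star_star]
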